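/- Let $n,r\ge 0$, let $G\subset GL(n,\mathbb R)$ be a closed subgroup, $V=\mathbb R^n$, and let $M$ be a nonempty smooth $n$-dimensional manifold. Let $FM\to M$ be the bundle of linear frames $u:V\to T_xM$, on which $G$ acts on the right by $u\cdot g=u\circ g$, and let $J^r(FM/G)$ be the space of $r$-jets $j^r_xs$ $(x\in M)$ of local smooth sections $s$ of $FM/G\to M$ ($r$-jets of $G$-structures); $J^r_0(FV/G)$ denotes the jets at $0$ of local sections of $FV/G$. A diffeomorphism $f$ between open subsets of $n$-manifolds induces a map $\tilde f[u]=[f_*\circ u]$ of the quotient frame bundles, and acts on local sections by $f\cdot s=\tilde f\circ s\circ f^{-1}$ and on jets by $$(j^{r+1}_xf)\cdot(j^r_xs)=j^r_{f(x)}(f\cdot s).$$ This is well defined, and gives an action on $J^r(FM/G)$ of the groupoid $J^{r+1}_{\mathrm{inv}}(M,M)$ of $(r+1)$-jets of local diffeomorphisms of $M$, and an action on $J^r_0(FV/G)$ of the group $\mathfrak G^{r+1}_0$ of $(r+1)$-jets at $0$ of local diffeomorphisms of $V$ fixing $0$. Let $\mathfrak M^r_G(M)=J^r(FM/G)/J^{r+1}_{\mathrm{inv}}(M,M)$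 be the moduli space of $r$-jets of $G$-structures on $M$. Then there is a unique bijection $$\mathfrak M^r_G(M)\;\cong\;J^r_0(FV/G)/\mathfrak G^{r+1}_0$$ such that $[j^r_xs]\mapsto[(j^{r+1}_x\varphi)\cdot(j^r_xs)]$ for every $x\in M$, every local section $s$ of $FM/G$ near $x$ and every chart $\varphi$ of $M$ centered at $x$ (i.e. $\varphi(x)=0$). In particular the moduli space does not depend on $M$: for every other nonempty smooth $n$-dimensional manifold $M'$ there is a unique bijection $\mathfrak M^r_G(M)\cong\mathfrak M^r_G(M')$ such that $[j^r_xs]\mapsto[(j^{r+1}_xf)\cdot(j^r_xs)]$ for every $x \in M$, every local section $s$ of $FM/G$ near $x$ and every diffeomorphism $f$ from an open neighbourhood of $x$ onto an open subset of $M'$. -/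

import Mathlib

open scoped Manifold ContDiff Topology

noncomputable section

namespace GJet

/-- The model space `V = ℝⁿ`. -/
abbrev V (n : ℕ) : Type := EuclideanSpace ℝ (Fin n)

/-! ### The linear frame bundle -/

/-- The bundle over `M` with fibre `Hom(V, T_x M)` at `x`. -/
abbrev HomBundle (n : ℕ) (M : Type*) [TopologicalSpace M] [ChartedSpace (V n) M]
    [IsManifold 𝓘(ℝ, V n) ∞ M] : Type _ :=
  Bundle.TotalSpace (V n →L[ℝ] V n)
    (fun x : M => Bundle.Trivial M (V n) x →L[ℝ] TangentSpace 𝓘(ℝ, V n) x)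

section Frames

variable (n : ℕ) (M : Type*) [TopologicalSpace M] [ChartedSpace (V n) M]
  [IsManifold 𝓘(ℝ, V n) ∞ M]

theorem isOpen_frames : IsOpen {e : HomBundle n M | e.2.IsInvertible} := by
  rw [isOpen_iff_mem_nhds]
  intro e he
  set t := trivializationAt (V n →L[ℝ] V n)
    (fun x : M => Bundle.Trivial M (V n) x →L[ℝ] TangentSpace 𝓘(ℝ, V n) x) e.1 with ht
  have key : ∀ e' : HomBundle n M, e' ∈ t.source →
      (e'.2.IsInvertible ↔ (t e').2.IsInvertible) := by
    intro e' he'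
    rw [ht, hom_trivializationAt_source] at he'
    rw [ht, hom_trivializationAt_apply]
    rw [ContinuousLinearMap.inCoordinates_eq he'.1 he'.2]
    simp
  have hsrc : e ∈ t.source := FiberBundle.mem_trivializationAt_proj_source
  have hc : ContinuousAt (fun e' => (t e').2) e :=
    continuous_snd.continuousAt.comp (t.continuousOn.continuousAt (t.open_source.mem_nhds hsrc))
  have hop : IsOpen {A : V n →L[ℝ] V n | A.IsInvertible} := ContinuousLinearEquiv.isOpen
  filter_upwards [hc (hop.mem_nhds ((key e hsrc).1 he)), t.open_source.mem_nhds hsrc] with e' h1 h2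
  exact (key e' h2).2 h1

/-- The linear frame bundle `FM`: the open submanifold of `Hom(V, TM)` of all linear
isomorphisms `u : V → T_x M`. The frame `(X₁, …, Xₙ)` is `u` with `u eᵢ = Xᵢ`. -/
def frameOpens : TopologicalSpace.Opens (HomBundle n M) :=
  ⟨{e | e.2.IsInvertible}, isOpen_frames n M⟩

abbrev FrameBundle : Type _ := frameOpens n M

end Frames

/-- The linear automorphism of `V` given by `g ∈ GL(n, ℝ)`. -/
def glHom {n : ℕ} (g : GL (Fin n) ℝ) : V n →L[ℝ] V n :=
  Matrix.toEuclideanCLM (𝕜 := ℝ) (g : Matrix (Fin n) (Fin n) ℝ)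

section Quotient

variable {n : ℕ} {M : Type*} [TopologicalSpace M] [ChartedSpace (V n) M]
  [IsManifold 𝓘(ℝ, V n) ∞ M]

theorem glHom_mul (g h : GL (Fin n) ℝ) : glHom (g * h) = glHom g ∘L glHom h := by
  simp only [glHom, Units.val_mul, map_mul]; rfl

theorem glHom_one : glHom (1 : GL (Fin n) ℝ) = ContinuousLinearMap.id ℝ (V n) := by
  simp only [glHom, Units.val_one, map_one]; rfl

theorem glHom_isInvertible (g : GL (Fin n) ℝ) : (glHom g).IsInvertible :=
  .of_inverse (g := glHom g⁻¹) (by rw [← glHom_mul, mul_inv_cancel, glHom_one])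
    (by rw [← glHom_mul, inv_mul_cancel, glHom_one])

/-- The base point of a frame. -/
def FrameBundle.pt (u : FrameBundle n M) : M := u.1.1

/-- A frame, as a linear map `V → T_x M`. -/
def FrameBundle.map (u : FrameBundle n M) : V n →L[ℝ] TangentSpace 𝓘(ℝ, V n) u.pt := u.1.2

/-- The frame at `x` given by an invertible linear map `V → T_x M`. -/
def FrameBundle.mk (x : M) (A : V n →L[ℝ] TangentSpace 𝓘(ℝ, V n) x) (hA : A.IsInvertible) :
    FrameBundle n M := ⟨⟨x, A⟩, hA⟩

/-- The right action `u · g = u ∘ g` of `GL(n, ℝ)` on `FM`, as a left action of the opposite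
group. -/
instance : MulAction (GL (Fin n) ℝ)ᵐᵒᵖ (FrameBundle n M) where
  smul g u := .mk u.pt (u.map ∘L glHom g.unop) (ContinuousLinearMap.IsInvertible.comp u.2
    (glHom_isInvertible _))
  one_smul u := by
    change FrameBundle.mk u.pt (u.map ∘L glHom 1) _ = u
    simp only [glHom_one]; rfl
  mul_smul g h u := by
    change FrameBundle.mk u.pt (u.map ∘L glHom (h.unop * g.unop)) _ =
      FrameBundle.mk u.pt ((u.map ∘L glHom h.unop) ∘L glHom g.unop) _
    simp only [glHom_mul]; rfl

variable (n M) in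
/-- The quotient `FM/G`, with the quotient topology. -/
abbrev FrameQuotient (G : Subgroup (GL (Fin n) ℝ)) : Type _ :=
  Quotient (MulAction.orbitRel G.op (FrameBundle n M))

variable {G : Subgroup (GL (Fin n) ℝ)}

/-- The projection `q : FM → FM/G`. -/
def quot (G : Subgroup (GL (Fin n) ℝ)) (u : FrameBundle n M) : FrameQuotient n M G :=
  Quotient.mk _ u

/-- The projection `FM/G → M`. -/
def FrameQuotient.pt : FrameQuotient n M G → M :=
  Quotient.lift FrameBundle.pt (by rintro _ _ ⟨g, rfl⟩; rfl)

/-- `h` is a smooth function on the open set `W` of the quotient manifold `FM/G`: it pulls back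
under `q` to a smooth function on the open set `q⁻¹(W)` of `FM`. Since `q` is a surjective
submersion, this sheaf of functions is the smooth structure of `FM/G`. -/
def IsSmoothFun (W : Set (FrameQuotient n M G)) (h : FrameQuotient n M G → ℝ) : Prop :=
  IsOpen W ∧ ContMDiffOn (𝓘(ℝ, V n).prod 𝓘(ℝ, V n →L[ℝ] V n)) 𝓘(ℝ, ℝ) ∞
    (fun u => h (quot G u)) (quot G ⁻¹' W)

/-- `s : U → FM/G` is a smooth map into the manifold `FM/G` (for `U ⊆ M` open): it is continuous
and pulls back locally defined smooth functions to smooth functions. -/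
def IsSmoothMapOn (U : Set M) (s : M → FrameQuotient n M G) : Prop :=
  ContinuousOn s U ∧ ∀ W h, IsSmoothFun W h →
    ContMDiffOn 𝓘(ℝ, V n) 𝓘(ℝ, ℝ) ∞ (fun y => h (s y)) (U ∩ s ⁻¹' W)

/-- A smooth local section of `FM/G → M` (that is, a `G`-structure) defined on an open
neighbourhood of `x`. The values of `toFun` outside `dom` are irrelevant. -/
structure LocalSection (G : Subgroup (GL (Fin n) ℝ)) (x : M) where
  dom : Set M
  isOpen_dom : IsOpen dom
  mem_dom : x ∈ dom
  toFun : M → FrameQuotient n M G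
  pt_toFun : ∀ y ∈ dom, (toFun y).pt = y
  smooth : IsSmoothMapOn dom toFun

end Quotient

/-! ### Jets -/

section Jets

variable {E : Type*} [NormedAddCommGroup E] [NormedSpace ℝ E]
  {E' : Type*} [NormedAddCommGroup E'] [NormedSpace ℝ E']
  {E'' : Type*} [NormedAddCommGroup E''] [NormedSpace ℝ E'']
  {M : Type*} [TopologicalSpace M] [ChartedSpace E M]
  {M' : Type*} [TopologicalSpace M'] [ChartedSpace E' M']
  {M'' : Type*} [TopologicalSpace M''] [ChartedSpace E'' M'']

variable (E E') in
/-- The maps `f` and `g` have the same `r`-jet at `x`: they agree at `x` and their expressions in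
charts around `x` and `f x = g x` have the same derivatives of order at most `r`. -/
def JetEq (r : ℕ) (x : M) (f g : M → M') : Prop :=
  f x = g x ∧ ∀ k ≤ r,
    iteratedFDeriv ℝ k (writtenInExtChartAt 𝓘(ℝ, E) 𝓘(ℝ, E') x f) (extChartAt 𝓘(ℝ, E) x x) =
    iteratedFDeriv ℝ k (writtenInExtChartAt 𝓘(ℝ, E) 𝓘(ℝ, E') x g) (extChartAt 𝓘(ℝ, E) x x)

theorem JetEq.refl (r : ℕ) (x : M) (f : M → M') : JetEq E E' r x f f := ⟨rfl, fun _ _ => rfl⟩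

theorem JetEq.symm {r : ℕ} {x : M} {f g : M → M'} (h : JetEq E E' r x f g) : JetEq E E' r x g f :=
  ⟨h.1.symm, fun k hk => (h.2 k hk).symm⟩

theorem JetEq.trans {r : ℕ} {x : M} {f g h : M → M'} (h₁ : JetEq E E' r x f g)
    (h₂ : JetEq E E' r x g h) : JetEq E E' r x f h :=
  ⟨h₁.1.trans h₂.1, fun k hk => (h₁.2 k hk).trans (h₂.2 k hk)⟩

theorem JetEq.of_eventuallyEq {r : ℕ} {x : M} {f g : M → M'} (h : f =ᶠ[𝓝 x] g) :
    JetEq E E' r x f g := by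
  have hx := h.self_of_nhds
  refine ⟨hx, fun k _ => ?_⟩
  refine Filter.EventuallyEq.eq_of_nhds (Filter.EventuallyEq.iteratedFDeriv ℝ ?_ k)
  have ht : Filter.Tendsto (extChartAt 𝓘(ℝ, E) x).symm (𝓝 (extChartAt 𝓘(ℝ, E) x x)) (𝓝 x) := by
    have := continuousAt_extChartAt_symm (I := 𝓘(ℝ, E)) x
    rwa [ContinuousAt, extChartAt_to_inv] at this
  filter_upwards [ht.eventually h] with z hz
  simp only [writtenInExtChartAt, Function.comp_apply, hx, hz]

theorem contDiffAt_written {x : M} {f : M → M'} (hf : ContMDiffAt 𝓘(ℝ, E) 𝓘(ℝ, E') ∞ f x) :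
    ContDiffAt ℝ ∞ (writtenInExtChartAt 𝓘(ℝ, E) 𝓘(ℝ, E') x f) (extChartAt 𝓘(ℝ, E) x x) := by
  have := (contMDiffAt_iff.1 hf).2
  simpa [writtenInExtChartAt, contDiffWithinAt_univ] using this

theorem JetEq.comp {r : ℕ} {x : M} {f f' : M → M'} {g g' : M' → M''}
    (hf : ContMDiffAt 𝓘(ℝ, E) 𝓘(ℝ, E') ∞ f x) (hf' : ContMDiffAt 𝓘(ℝ, E) 𝓘(ℝ, E') ∞ f' x)
    (hg : ContMDiffAt 𝓘(ℝ, E') 𝓘(ℝ, E'') ∞ g (f x))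
    (hg' : ContMDiffAt 𝓘(ℝ, E') 𝓘(ℝ, E'') ∞ g' (f x))
    (h₁ : JetEq E E' r x f f') (h₂ : JetEq E' E'' r (f x) g g') : JetEq E E'' r x (g ∘ f) (g' ∘ f') := by
  have aux : ∀ (f : M → M') (g : M' → M''), ContMDiffAt 𝓘(ℝ, E) 𝓘(ℝ, E') ∞ f x →
      ContMDiffAt 𝓘(ℝ, E') 𝓘(ℝ, E'') ∞ g (f x) → ∀ k : ℕ,
      iteratedFDeriv ℝ k (writtenInExtChartAt 𝓘(ℝ, E) 𝓘(ℝ, E'') x (g ∘ f))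
        (extChartAt 𝓘(ℝ, E) x x) =
      (ftaylorSeries ℝ (writtenInExtChartAt 𝓘(ℝ, E') 𝓘(ℝ, E'') (f x) g)
        (extChartAt 𝓘(ℝ, E') (f x) (f x))).taylorComp
      (ftaylorSeries ℝ (writtenInExtChartAt 𝓘(ℝ, E) 𝓘(ℝ, E') x f)
        (extChartAt 𝓘(ℝ, E) x x)) k := by
    intro f g hf hg k
    have hval : writtenInExtChartAt 𝓘(ℝ, E) 𝓘(ℝ, E') x f (extChartAt 𝓘(ℝ, E) x x) =
        extChartAt 𝓘(ℝ, E') (f x) (f x) := by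
      simp only [writtenInExtChartAt, Function.comp_apply, extChartAt_to_inv]
    have hG := contDiffAt_written hg
    rw [← hval] at hG ⊢
    rw [← iteratedFDeriv_comp hG (contDiffAt_written hf) (i := k) (by exact_mod_cast le_top)]
    refine Filter.EventuallyEq.eq_of_nhds (Filter.EventuallyEq.iteratedFDeriv ℝ ?_ k)
    have ht : Filter.Tendsto (extChartAt 𝓘(ℝ, E) x).symm (𝓝 (extChartAt 𝓘(ℝ, E) x x)) (𝓝 x) := by
      have := continuousAt_extChartAt_symm (I := 𝓘(ℝ, E)) x
      rwa [ContinuousAt, extChartAt_to_inv] at this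
    filter_upwards [ht.eventually (hf.continuousAt.eventually
      (extChartAt_source_mem_nhds (I := 𝓘(ℝ, E')) (f x)))] with z hz
    simp only [writtenInExtChartAt, Function.comp_apply]
    rw [(extChartAt 𝓘(ℝ, E') (f x)).left_inv hz]
  refine ⟨by simp only [Function.comp_apply, ← h₁.1, h₂.1], fun k hk => ?_⟩
  rw [aux f g hf hg k, aux f' g' hf' (h₁.1 ▸ hg') k, ← h₁.1]
  simp only [FormalMultilinearSeries.taylorComp]
  refine Finset.sum_congr rfl fun c _ => ?_
  have e1 : ∀ m ≤ k, ftaylorSeries ℝ (writtenInExtChartAt 𝓘(ℝ, E) 𝓘(ℝ, E') x f)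
        (extChartAt 𝓘(ℝ, E) x x) m = ftaylorSeries ℝ (writtenInExtChartAt 𝓘(ℝ, E) 𝓘(ℝ, E') x f')
        (extChartAt 𝓘(ℝ, E) x x) m := fun m hm => h₁.2 m (hm.trans hk)
  have e2 := h₂.2 c.length (c.length_le.trans hk)
  exact congrArg₂ c.compAlongOrderedFinpartition e2 (funext fun m => e1 _ (c.partSize_le m))

end Jets

/-! ### Jets of local diffeomorphisms -/

section InvJets

variable {n : ℕ} {M : Type*} [TopologicalSpace M] [ChartedSpace (V n) M]
  {M' : Type*} [TopologicalSpace M'] [ChartedSpace (V n) M']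
  {M'' : Type*} [TopologicalSpace M''] [ChartedSpace (V n) M'']

variable (n M M') in
/-- Smooth diffeomorphisms from an open subset (`source`) of `M` onto an open subset (`target`)
of `M'`. -/
abbrev LocalDiffeo : Type _ := PartialDiffeomorph 𝓘(ℝ, V n) 𝓘(ℝ, V n) M M' ∞

/-- Local diffeomorphisms defined near `x` and mapping `x` to `y`. -/
structure LocalDiffeoAt (n : ℕ) {M : Type*} [TopologicalSpace M] [ChartedSpace (V n) M]
    {M' : Type*} [TopologicalSpace M'] [ChartedSpace (V n) M'] (x : M) (y : M') where
  toDiffeo : LocalDiffeo n M M'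
  mem_source : x ∈ toDiffeo.source
  map_eq : toDiffeo x = y

namespace LocalDiffeoAt

variable {x : M} {y : M'} {z : M''}

theorem contMDiffAt (f : LocalDiffeoAt n x y) :
    ContMDiffAt 𝓘(ℝ, V n) 𝓘(ℝ, V n) ∞ f.toDiffeo x :=
  f.toDiffeo.contMDiffOn.contMDiffAt (f.toDiffeo.open_source.mem_nhds f.mem_source)

theorem mem_target (f : LocalDiffeoAt n x y) : y ∈ f.toDiffeo.target :=
  (congrArg (· ∈ f.toDiffeo.target) f.map_eq).mp (f.toDiffeo.map_source f.mem_source)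

/-- The identity. -/
def refl (x : M) : LocalDiffeoAt n x x :=
  ⟨(Diffeomorph.refl 𝓘(ℝ, V n) M ∞).toPartialDiffeomorph, Set.mem_univ _, rfl⟩

/-- The inverse. -/
def symm (f : LocalDiffeoAt n x y) : LocalDiffeoAt n y x :=
  ⟨f.toDiffeo.symm, f.mem_target,
    (congrArg f.toDiffeo.symm f.map_eq).symm.trans (f.toDiffeo.left_inv f.mem_source)⟩

/-- The composition `g ∘ f`. -/
def comp (g : LocalDiffeoAt n y z) (f : LocalDiffeoAt n x y) : LocalDiffeoAt n x z :=
  ⟨f.toDiffeo.trans g.toDiffeo,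
    ⟨f.mem_source, show f.toDiffeo x ∈ g.toDiffeo.source from
      (congrArg (· ∈ g.toDiffeo.source) f.map_eq).mpr g.mem_source⟩,
    show g.toDiffeo (f.toDiffeo x) = z from
      (congrArg g.toDiffeo f.map_eq).trans g.map_eq⟩

end LocalDiffeoAt

/-- Equality of `k`-jets at `x` of local diffeomorphisms mapping `x` to `y`. -/
def diffeoJetSetoid (k : ℕ) (x : M) (y : M') : Setoid (LocalDiffeoAt n x y) where
  r f g := JetEq (V n) (V n) k x f.toDiffeo g.toDiffeo
  iseqv := ⟨fun _ => .refl _ _ _, .symm, .trans⟩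

/-- The `k`-jets with source `x` and target `y` of local diffeomorphisms `M → M'`. For `M' = M`
these are the elements of the groupoid of invertible jets of `M` with source `x` and target
`y`. -/
def InvJet (n k : ℕ) {M : Type*} [TopologicalSpace M] [ChartedSpace (V n) M]
    {M' : Type*} [TopologicalSpace M'] [ChartedSpace (V n) M'] (x : M) (y : M') : Type _ :=
  Quotient (diffeoJetSetoid (n := n) k x y)

namespace InvJet

variable {k : ℕ} {x : M} {y : M'} {z : M''}

/-- The `k`-jet at `x` of `f`. -/
def mk (k : ℕ) (f : LocalDiffeoAt n x y) : InvJet n k x y :=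
  Quotient.mk (diffeoJetSetoid k x y) f

theorem comp_aux {g g' : LocalDiffeoAt n y z} {f f' : LocalDiffeoAt n x y}
    (hg : JetEq (V n) (V n) k y g.toDiffeo g'.toDiffeo) (hf : JetEq (V n) (V n) k x f.toDiffeo f'.toDiffeo) :
    JetEq (V n) (V n) k x (g.comp f).toDiffeo (g'.comp f').toDiffeo := by
  have hC : ∀ g : LocalDiffeoAt n y z,
      ContMDiffAt 𝓘(ℝ, V n) 𝓘(ℝ, V n) ∞ g.toDiffeo (f.toDiffeo x) := fun g =>
    (congrArg (fun w => ContMDiffAt 𝓘(ℝ, V n) 𝓘(ℝ, V n) ∞ g.toDiffeo w) f.map_eq).mpr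
      g.contMDiffAt
  exact JetEq.comp (f := f.toDiffeo) (f' := f'.toDiffeo) (g := g.toDiffeo) (g' := g'.toDiffeo)
    f.contMDiffAt f'.contMDiffAt (hC g) (hC g') hf
    ((congrArg (fun w => JetEq (V n) (V n) k w g.toDiffeo g'.toDiffeo) f.map_eq).mpr hg)

/-- Composition of jets: `(j_y g) (j_x f) = j_x (g ∘ f)`. -/
def comp (β : InvJet n k y z) (α : InvJet n k x y) : InvJet n k x z :=
  Quotient.map₂ (sa := diffeoJetSetoid k y z) (sb := diffeoJetSetoid k x y)
    (sc := diffeoJetSetoid k x z) LocalDiffeoAt.comp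
    (fun _ _ hg _ _ hf => comp_aux hg hf) β α

theorem symm_comp_eq (f : LocalDiffeoAt n x y) :
    JetEq (V n) (V n) k x (f.symm.comp f).toDiffeo (LocalDiffeoAt.refl (n := n) x).toDiffeo := by
  refine .of_eventuallyEq ?_
  filter_upwards [f.toDiffeo.open_source.mem_nhds f.mem_source] with z hz
  exact f.toDiffeo.left_inv hz

theorem comp_symm_eq (f : LocalDiffeoAt n x y) :
    JetEq (V n) (V n) k y (f.comp f.symm).toDiffeo (LocalDiffeoAt.refl (n := n) y).toDiffeo := by
  refine .of_eventuallyEq ?_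
  filter_upwards [f.toDiffeo.open_target.mem_nhds f.mem_target] with z hz
  exact f.toDiffeo.right_inv hz

theorem inv_aux {f f' : LocalDiffeoAt n x y} (hf : JetEq (V n) (V n) k x f.toDiffeo f'.toDiffeo) :
    JetEq (V n) (V n) k y f.symm.toDiffeo f'.symm.toDiffeo := by
  have h1 : JetEq (V n) (V n) k y f.symm.toDiffeo (f.symm.comp (f'.comp f'.symm)).toDiffeo :=
    comp_aux (g := f.symm) (f := .refl y) (.refl _ _ _) (comp_symm_eq f').symm
  have h2 : JetEq (V n) (V n) k y (f.symm.comp (f'.comp f'.symm)).toDiffeo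
      (f.symm.comp (f.comp f'.symm)).toDiffeo :=
    comp_aux (.refl _ _ _) (comp_aux hf.symm (.refl _ _ _))
  have h3 : JetEq (V n) (V n) k y ((f.symm.comp f).comp f'.symm).toDiffeo f'.symm.toDiffeo :=
    comp_aux (g' := .refl x) (f' := f'.symm) (symm_comp_eq f) (.refl _ _ _)
  exact h1.trans (h2.trans h3)

/-- The inverse jet. -/
def inv (α : InvJet n k x y) : InvJet n k y x :=
  Quotient.map (sa := diffeoJetSetoid k x y) (sb := diffeoJetSetoid k y x) LocalDiffeoAt.symm
    (fun _ _ hf => inv_aux hf) α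

/-- The group of `k`-jets at `x` of local diffeomorphisms fixing `x`, under composition. -/
instance (x : M) : Group (InvJet n k x x) where
  mul := comp
  one := mk k (.refl x)
  inv := inv
  mul_assoc := by rintro ⟨a⟩ ⟨b⟩ ⟨c⟩; exact Quotient.sound (.refl _ _ _)
  one_mul := by rintro ⟨a⟩; exact Quotient.sound (.refl _ _ _)
  mul_one := by rintro ⟨a⟩; exact Quotient.sound (.refl _ _ _)
  inv_mul_cancel := by rintro ⟨a⟩; exact Quotient.sound (symm_comp_eq a)

end InvJet

/-- The group `𝔊₀ᵏ` of `k`-jets at `0` of diffeomorphisms of `V` fixing `0`. -/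
abbrev JetGroup (n k : ℕ) : Type := InvJet n k (0 : V n) (0 : V n)

theorem LocalDiffeo.mfderiv_isInvertible (f : LocalDiffeo n M M') {x : M} (hx : x ∈ f.source) :
    (mfderiv 𝓘(ℝ, V n) 𝓘(ℝ, V n) f x).IsInvertible :=
  ⟨(PartialDiffeomorph.isLocalDiffeomorphAt 𝓘(ℝ, V n) 𝓘(ℝ, V n) ∞ f hx).mfderivToContinuousLinearEquiv (by simp), rfl⟩

end InvJets

/-! ### Jets of `G`-structures and the action of jets of diffeomorphisms -/

section Moduli

variable {n : ℕ} {G : Subgroup (GL (Fin n) ℝ)}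
  {M : Type*} [TopologicalSpace M] [ChartedSpace (V n) M] [IsManifold 𝓘(ℝ, V n) ∞ M]
  {M' : Type*} [TopologicalSpace M'] [ChartedSpace (V n) M'] [IsManifold 𝓘(ℝ, V n) ∞ M']

/-- Two local sections have the same `r`-jet at `x`: they have the same value at `x` and
composing them with smooth functions of the manifold `FM/G` defined around this value gives
functions with the same `r`-jet at `x`. -/
def sectionJetSetoid (G : Subgroup (GL (Fin n) ℝ)) (r : ℕ) (x : M) :
    Setoid (LocalSection G x) where
  r s t := s.toFun x = t.toFun x ∧ ∀ W h, IsSmoothFun W h → s.toFun x ∈ W →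
    JetEq (V n) ℝ r x (fun y => h (s.toFun y)) (fun y => h (t.toFun y))
  iseqv :=
    ⟨fun _ => ⟨rfl, fun _ _ _ _ => .refl _ _ _⟩,
     fun H => ⟨H.1.symm, fun W h hh hW => (H.2 W h hh (H.1 ▸ hW)).symm⟩,
     fun H K => ⟨H.1.trans K.1, fun W h hh hW =>
      (H.2 W h hh hW).trans (K.2 W h hh (H.1 ▸ hW))⟩⟩

/-- The space `J_xʳ(FM/G)` of `r`-jets at `x` of `G`-structures. -/
def SectionJet (G : Subgroup (GL (Fin n) ℝ)) (r : ℕ) (x : M) : Type _ :=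
  Quotient (sectionJetSetoid G r x)

/-- The `r`-jet at `x` of a local section. -/
def SectionJet.mk (r : ℕ) {x : M} (s : LocalSection G x) : SectionJet G r x :=
  Quotient.mk (sectionJetSetoid G r x) s

variable (M) in
/-- The space `Jʳ(FM/G)` of `r`-jets of `G`-structures on `M`. -/
def SectionJetSpace (G : Subgroup (GL (Fin n) ℝ)) (r : ℕ) : Type _ :=
  Σ x : M, SectionJet G r x

open Classical in
/-- The map `FM → FM'`, `(x; X₁, …, Xₙ) ↦ (f x; f_* X₁, …, f_* Xₙ)` induced by a local
diffeomorphism `f`, defined over `f.source` (elsewhere it has an irrelevant value). -/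
def frameMap (f : LocalDiffeo n M M') (u : FrameBundle n M) : FrameBundle n M' :=
  if h : u.pt ∈ f.source then
    .mk (f u.pt) (mfderiv 𝓘(ℝ, V n) 𝓘(ℝ, V n) f u.pt ∘L u.map)
      (.comp (LocalDiffeo.mfderiv_isInvertible f h) u.2)
  else .mk (f u.pt) (ContinuousLinearMap.id ℝ (V n)) ⟨.refl ℝ (V n), rfl⟩

/-- The map `FM/G → FM'/G`, `[u] ↦ [f_* u]` induced by a local diffeomorphism `f`, defined over
`f.source`. -/
def quotMap (f : LocalDiffeo n M M') : FrameQuotient n M G → FrameQuotient n M' G :=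
  Quotient.lift (fun u => quot G (frameMap f u)) (by
    rintro _ u ⟨g, rfl⟩
    by_cases h : u.pt ∈ f.source
    · refine Quotient.sound ⟨g, ?_⟩
      have h' : FrameBundle.pt (g • u) ∈ f.source := h
      simp only [frameMap, dif_pos h, dif_pos h']
      rfl
    · have h' : FrameBundle.pt (g • u) ∉ f.source := h
      simp only [frameMap, dif_neg h, dif_neg h']
      rfl)

/-- The direct image `f · s = f̃ ∘ s ∘ f⁻¹` of a section `s` of `FM/G`, defined on `f.target`. -/
def pushforward (f : LocalDiffeo n M M') (s : M → FrameQuotient n M G) :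
    M' → FrameQuotient n M' G :=
  fun y => quotMap f (s (f.symm y))

/-- The graph of the action of jets of local diffeomorphisms on jets of `G`-structures:
`j'` is `(j_x^{r+1} f) · (j_x^r s) = j_{f x}^r (f · s)`, where `α = j_x^{r+1} f`, `j = j_x^r s`
and `f x = y`. -/
def IsTranslate {r : ℕ} {x : M} {y : M'} (α : InvJet n (r + 1) x y) (j : SectionJet G r x)
    (j' : SectionJet G r y) : Prop :=
  ∃ (f : LocalDiffeoAt n x y) (s : LocalSection G x) (s' : LocalSection G y),
    α = .mk (r + 1) f ∧ j = .mk r s ∧ s'.toFun =ᶠ[𝓝 y] pushforward f.toDiffeo s.toFun ∧ j' = .mk r s'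

/-- Two `r`-jets of `G`-structures on `M` are in the same orbit of the groupoid of `(r+1)`-jets of
local diffeomorphisms of `M`. -/
def SameOrbit {r : ℕ} (j j' : SectionJetSpace M G r) : Prop :=
  ∃ α : InvJet n (r + 1) j.1 j'.1, IsTranslate α j.2 j'.2

variable (M) in
/-- The moduli space `𝔐_Gʳ(M)` of `r`-jets of `G`-structures on `M`. -/
def Moduli (G : Subgroup (GL (Fin n) ℝ)) (r : ℕ) : Type _ :=
  Quot (SameOrbit : SectionJetSpace M G r → SectionJetSpace M G r → Prop)

/-- The class in the moduli space of an `r`-jet at `x`. -/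
def Moduli.mk {r : ℕ} {x : M} (j : SectionJet G r x) : Moduli M G r := Quot.mk _ ⟨x, j⟩

end Moduli

end GJet

end

/-!
The moduli statement is formal once `j^{r+1} f · j^r s = j^r (f · s)` is known to be well defined:
jets of local diffeomorphisms, between possibly different manifolds, then act functorially on jets
of `G`-structures (`InvJet.translate`, `InvJet.translate_refl`, `InvJet.translate_comp`). Every point
of a manifold has a chart centered at it (`centeredChart`), and conjugating by such charts turns
equivalence of jets on `M` into equivalence under the group of jets at `0`
(`JetOrbits.mk_translate_eq_iff`). This gives the bijection `moduliEquiv`; two of them compose to the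
comparison of `M` with `M'`. A bijection with the required property is unique because each class has
a representative to which the property applies.

The analytic content is `sectionJet_pushforward_eq`: if `f, f'` have the same `(r+1)`-jet at `x` and
`s, s'` the same `r`-jet, then `f · s, f' · s'` have the same `r`-jet. Jets of sections are tested on
smooth functions `φ` of `FM'/G`, and `φ ∘ f̃` is such a function on `FM/G`, so replacing `s` by `s'` is
harmless; what remains is to replace `f` by `f'`. In charts the induced map on frames is
`(z, B) ↦ (F z, DF(z) ∘ B)`. Hence, in coordinates centered at `x`, the induced maps of `f` and `f'`
differ by `O(|z|^{r+1})` near every frame over `x`, and so do their compositions with the smooth,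
hence locally Lipschitz, function `φ ∘ q`. The bound involves the base point alone. Since `q` is open,
it descends to `FM/G`, and composing with the continuous section `s` shows that `φ ∘ f̃ ∘ s` and
`φ ∘ f̃' ∘ s` differ by `O(|z|^{r+1})`. For smooth functions this is equality of `r`-jets
(`iteratedFDeriv_eq_zero_of_isBigO`), by Taylor's formula and the symmetry of higher derivatives. The
manifold structure of `FM/G` and local lifts of sections to `FM` are not used.
-/

noncomputable section

namespace GJet

/-! ### Jets and orders of vanishing -/

section Taylor

variable {E F : Type*} [NormedAddCommGroup E] [NormedSpace ℝ E] [NormedAddCommGroup F]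
  [NormedSpace ℝ F]

open Asymptotics Filter

/-- The `k`-th derivative of a `Cᵏ` function is symmetric. The symmetric group is generated by
adjacent transpositions; those fixing the first argument come from the symmetry of the derivative
of order `k - 1` near `x`, and the first one from the symmetry of the second derivative of the
derivative of order `k - 2`. -/
theorem _root_.ContDiffAt.iteratedFDeriv_perm {g : E → F} {x : E} {k : ℕ} (hg : ContDiffAt ℝ k g x)
    (σ : Equiv.Perm (Fin k)) (v : Fin k → E) :
    iteratedFDeriv ℝ k g x (fun i => v (σ i)) = iteratedFDeriv ℝ k g x v := by
  have hd : ∀ (j : ℕ) {z : E}, ContDiffAt ℝ ((j + 1 : ℕ) : ℕ∞ω) g z →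
      DifferentiableAt ℝ (iteratedFDeriv ℝ j g) z := fun j z hz =>
    hz.differentiableAt_iteratedFDeriv (by exact_mod_cast j.lt_succ_self)
  induction k generalizing x with
  | zero => congr 1; ext i; exact i.elim0
  | succ k ih =>
  have hσ : σ ∈ Submonoid.closure (Set.range fun i : Fin k => Equiv.swap i.castSucc i.succ) := by
    rw [Equiv.Perm.mclosure_swap_castSucc_succ]; trivial
  induction hσ using Submonoid.closure_induction generalizing v with
  | one => rfl
  | mul σ τ _ _ h₁ h₂ => exact (h₂ fun i => v (σ i)).trans (h₁ v)
  | mem σ hσ =>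
  obtain ⟨i, rfl⟩ := hσ
  rcases k with _ | k
  · exact i.elim0
  refine Fin.cases ?_ (fun i => ?_) i
  · have hG2 : ContDiffAt ℝ 2 (iteratedFDeriv ℝ k g) x :=
      hg.iteratedFDeriv_right (by rw [add_comm]; exact_mod_cast le_rfl)
    have hG : IsSymmSndFDerivAt ℝ (iteratedFDeriv ℝ k g) x := hG2.isSymmSndFDerivAt (by simp)
    have hd1 : ContDiffAt ℝ 1 (fderiv ℝ (iteratedFDeriv ℝ k g)) x :=
      hG2.fderiv_right (by norm_num)
    have hd2 := hd1.differentiableAt one_ne_zero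
    have key : ∀ w : Fin (k + 2) → E, iteratedFDeriv ℝ (k + 2) g x w =
        fderiv ℝ (fderiv ℝ (iteratedFDeriv ℝ k g)) x (w 0) (w 1) (Fin.tail (Fin.tail w)) := by
      intro w
      rw [(hd (k + 1) hg).iteratedFDeriv_succ_apply_left']
      simp only [iteratedFDeriv_succ_apply_left]
      rw [fderiv_continuousMultilinear_apply_const_apply
        (hd2.clm_apply (differentiableAt_const _)), fderiv_clm_apply hd2 (differentiableAt_const _)]
      simp [Fin.tail]
    have htail : (Fin.tail (Fin.tail fun j => v (Equiv.swap (Fin.castSucc 0) (Fin.succ 0) j))) =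
        Fin.tail (Fin.tail v) := by
      ext j
      simp only [Fin.tail]
      rw [Equiv.swap_apply_of_ne_of_ne]
      · simp [Fin.ext_iff]
      · simp [Fin.ext_iff]
    rw [key, key, htail]
    have e0 : Equiv.swap (Fin.castSucc 0) (Fin.succ 0) (0 : Fin (k + 2)) = 1 :=
      Equiv.swap_apply_left _ _
    have e1 : Equiv.swap (Fin.castSucc 0) (Fin.succ 0) (1 : Fin (k + 2)) = 0 :=
      Equiv.swap_apply_right _ _
    rw [e0, e1, hG.eq]
  · rw [(hd _ hg).iteratedFDeriv_succ_apply_left', (hd _ hg).iteratedFDeriv_succ_apply_left']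
    have e0 : Equiv.swap i.succ.castSucc i.succ.succ (0 : Fin (k + 2)) = 0 :=
      Equiv.swap_apply_of_ne_of_ne (by simp [Fin.ext_iff]) (by simp [Fin.ext_iff])
    have htail : (Fin.tail fun j => v (Equiv.swap i.succ.castSucc i.succ.succ j)) =
        fun j => Fin.tail v (Equiv.swap i.castSucc i.succ j) := by
      ext j
      simp only [Fin.tail]
      congr 1
      rw [← Fin.succ_castSucc]
      exact ((Fin.succ_injective _).swap_apply _ _ _)
    rw [e0, htail]
    have hev : (fun z => iteratedFDeriv ℝ (k + 1) g z
        fun j => Fin.tail v (Equiv.swap i.castSucc i.succ j)) =ᶠ[𝓝 x]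
        fun z => iteratedFDeriv ℝ (k + 1) g z (Fin.tail v) := by
      filter_upwards [(hg.of_le (by exact_mod_cast (k + 1).le_succ)).eventually (n := (k + 1 : ℕ))
        (by exact_mod_cast WithTop.coe_ne_top)] with z hz
      exact ih hz _ _
    rw [hev.fderiv_eq]

variable [CompleteSpace F]

theorem taylor_isBigO {g : E → F} {x : E} (hg : ContDiffAt ℝ ∞ g x) (r : ℕ) :
    (fun y => g (x + y) - ∑ k ∈ Finset.range (r + 1),
      ((k.factorial : ℝ)⁻¹ • iteratedFDeriv ℝ k g x fun _ => y)) =O[𝓝 0]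
      fun y => ‖y‖ ^ (r + 1) := by
  have h1 : ∀ᶠ z in 𝓝 x, ContDiffAt ℝ ((r + 1 : ℕ) : ℕ∞ω) g z :=
    (hg.of_le (by exact_mod_cast le_top)).eventually (by simp)
  have hc : ContinuousAt (iteratedFDeriv ℝ (r + 1) g) x :=
    hg.continuousAt_iteratedFDeriv (by exact_mod_cast le_top)
  have h2 : ∀ᶠ z in 𝓝 x, ‖iteratedFDeriv ℝ (r + 1) g z‖ < ‖iteratedFDeriv ℝ (r + 1) g x‖ + 1 :=
    hc.norm.eventually_lt_const (lt_add_one _)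
  obtain ⟨ε, hε, hball⟩ := Metric.eventually_nhds_iff_ball.1 (h1.and h2)
  refine IsBigO.of_bound (((r.factorial : ℝ)⁻¹) * (‖iteratedFDeriv ℝ (r + 1) g x‖ + 1)) ?_
  filter_upwards [Metric.ball_mem_nhds (0 : E) hε] with y hy
  have hmem : ∀ t ∈ Set.Icc (0 : ℝ) 1, x + t • y ∈ Metric.ball x ε := by
    intro t ht
    rw [mem_ball_iff_norm, add_sub_cancel_left, norm_smul, Real.norm_of_nonneg ht.1]
    rw [mem_ball_zero_iff] at hy
    exact (mul_le_of_le_one_left (norm_nonneg _) ht.2).trans_lt hy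
  have hT := map_add_eq_sum_add_integral_iteratedFDeriv (f := g) (x := x) (y := y) (n := r)
    fun t ht => by exact_mod_cast (hball _ (hmem t ht)).1
  rw [hT, add_sub_cancel_left, norm_smul, norm_inv,
    RCLike.norm_natCast, mul_assoc, norm_pow, norm_norm]
  gcongr
  refine (intervalIntegral.norm_integral_le_of_norm_le_const
    (C := (‖iteratedFDeriv ℝ (r + 1) g x‖ + 1) * ‖y‖ ^ (r + 1)) fun t ht => ?_).trans (by simp)
  rw [Set.uIoc_of_le zero_le_one] at ht
  have ht' : t ∈ Set.Icc (0 : ℝ) 1 := ⟨ht.1.le, ht.2⟩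
  have e1 : ‖(1 - t) ^ r‖ ≤ 1 := by
    rw [norm_pow]
    refine pow_le_one₀ (norm_nonneg _) ?_
    rw [Real.norm_of_nonneg (by linarith [ht.2])]
    linarith [ht.1]
  have e2 := (iteratedFDeriv ℝ (r + 1) g (x + t • y)).le_opNorm fun _ => y
  rw [Finset.prod_const, Finset.card_univ, Fintype.card_fin] at e2
  rw [norm_smul]
  refine (mul_le_of_le_one_left (norm_nonneg _) e1).trans (e2.trans ?_)
  gcongr
  exact (hball _ (hmem t ht')).2.le

theorem isBigO_of_iteratedFDeriv_eq_zero {g : E → F} {x : E} (hg : ContDiffAt ℝ ∞ g x) {r : ℕ}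
    (h : ∀ k ≤ r, iteratedFDeriv ℝ k g x = 0) :
    g =O[𝓝 x] fun y => ‖y - x‖ ^ (r + 1) := by
  have h0 : Tendsto (fun z => z - x) (𝓝 x) (𝓝 0) := by
    simpa using (by fun_prop : Continuous fun z : E => z - x).tendsto x
  have := (taylor_isBigO hg r).comp_tendsto h0
  refine this.congr_left fun z => ?_
  simp only [Function.comp_apply, add_sub_cancel]
  rw [Finset.sum_eq_zero, sub_zero]
  intro k hk
  rw [h k (Nat.lt_succ_iff.1 (Finset.mem_range.1 hk))]
  simp

/-- A smooth function vanishing to order `r + 1` has zero `r`-jet: by Taylor's formula, its first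
nonzero derivative would be a symmetric multilinear map vanishing on the diagonal. -/
theorem iteratedFDeriv_eq_zero_of_isBigO {g : E → F} {x : E} (hg : ContDiffAt ℝ ∞ g x) {r : ℕ}
    (h : g =O[𝓝 x] fun y => ‖y - x‖ ^ (r + 1)) : ∀ k ≤ r, iteratedFDeriv ℝ k g x = 0 := by
  intro k
  induction k using Nat.strong_induction_on with
  | _ k ih =>
  intro hk
  have h0 : Tendsto (fun z => x + z) (𝓝 0) (𝓝 x) := by
    simpa using (by fun_prop : Continuous fun z : E => x + z).tendsto 0
  have hle : (fun y : E => ‖y‖ ^ (r + 1)) =O[𝓝 0] fun y => ‖y‖ ^ (k + 1) := by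
    refine IsBigO.of_bound 1 ?_
    filter_upwards [Metric.ball_mem_nhds (0 : E) one_pos] with y hy
    rw [mem_ball_zero_iff] at hy
    rw [one_mul, norm_pow, norm_pow, norm_norm]
    exact pow_le_pow_of_le_one (norm_nonneg _) hy.le (by omega)
  have h1 : (fun y => g (x + y)) =O[𝓝 0] fun y => ‖y‖ ^ (k + 1) := by
    refine IsBigO.trans ?_ hle
    simpa [Function.comp_def] using h.comp_tendsto h0
  have h2 := h1.sub (taylor_isBigO hg k)
  have h3 : (fun y => ((k.factorial : ℝ)⁻¹ • iteratedFDeriv ℝ k g x) fun _ => y) =O[𝓝 0]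
      fun y => ‖y‖ ^ (k + 1) := by
    refine h2.congr_left fun y => ?_
    rw [sub_sub_cancel, Finset.sum_range_succ, Finset.sum_eq_zero, zero_add]
    · rfl
    · intro j hj
      rw [ih j (Finset.mem_range.1 hj) ((Finset.mem_range.1 hj).le.trans hk)]
      simp
  have hdiag : ∀ y, (iteratedFDeriv ℝ k g x) (fun _ => y) = 0 := by
    intro y
    have := h3.continuousMultilinearMap_apply_eq_zero y
    exact (smul_eq_zero.1 this).resolve_left (by positivity)
  -- polarization: differentiating the zero function `y ↦ Dᵏg(y, …, y)` gives a sum over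
  -- permutations, whose `k!` terms agree by symmetry
  ext v
  have h4 := (iteratedFDeriv ℝ k g x).iteratedFDeriv_comp_diagonal 0 v
  have h5 : (fun y => (iteratedFDeriv ℝ k g x) fun _ => y) = 0 := funext hdiag
  rw [h5] at h4
  have h6 : ∀ σ : Equiv.Perm (Fin k), iteratedFDeriv ℝ k g x (fun i => v (σ i)) =
      iteratedFDeriv ℝ k g x v := fun σ =>
    ContDiffAt.iteratedFDeriv_perm (hg.of_le (by exact_mod_cast le_top)) σ v
  simp only [h6, Finset.sum_const, Finset.card_univ, Fintype.card_perm, Fintype.card_fin] at h4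
  have h7 : (k.factorial : ℝ) • iteratedFDeriv ℝ k g x v = 0 := by
    rw [Nat.cast_smul_eq_nsmul, ← h4]; simp
  simpa using (smul_eq_zero.1 h7).resolve_left (by positivity)

end Taylor

/-! ### Coordinates on the frame bundle -/

section FrameCoordinates

open Bundle Filter

variable {n : ℕ} {M : Type*} [TopologicalSpace M] [ChartedSpace (V n) M]
  [IsManifold 𝓘(ℝ, V n) ∞ M]
  {M' : Type*} [TopologicalSpace M'] [ChartedSpace (V n) M'] [IsManifold 𝓘(ℝ, V n) ∞ M']

/-- The coordinates on `T_p M` given by the trivialization of the tangent bundle at `x`. This is the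
derivative at `p` of the chart at `x` if `p` lies in the domain of this chart, and zero otherwise.
-/
def tangentCoord (x p : M) : TangentSpace 𝓘(ℝ, V n) p →L[ℝ] V n :=
  (trivializationAt (V n) (TangentSpace 𝓘(ℝ, V n)) x).continuousLinearMapAt ℝ p

/-- The linear part of a frame in the chart at `x`. Together with the base point, it gives the charts
of the frame bundle. -/
def frameCoord (x : M) (u : FrameBundle n M) : V n →L[ℝ] V n := tangentCoord x u.pt ∘L u.map

theorem inCoordinates_eq_comp (x p : M) (A : V n →L[ℝ] TangentSpace 𝓘(ℝ, V n) p) :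
    ContinuousLinearMap.inCoordinates (V n) (Trivial M (V n)) (V n)
      (TangentSpace 𝓘(ℝ, V n) : M → Type) x p x p A = tangentCoord x p ∘L A := by
  ext v
  simp [ContinuousLinearMap.inCoordinates, tangentCoord]

theorem extChartAt_frameBundle (u₀ u : FrameBundle n M) :
    extChartAt (𝓘(ℝ, V n).prod 𝓘(ℝ, V n →L[ℝ] V n)) u₀ u =
      (extChartAt 𝓘(ℝ, V n) u₀.pt u.pt, frameCoord u₀.pt u) := by
  have h : chartAt (ModelProd (V n) (V n →L[ℝ] V n)) u₀ u =
      chartAt (ModelProd (V n) (V n →L[ℝ] V n)) u₀.1 u.1 := rfl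
  simp only [extChartAt_coe, Function.comp_apply, h]
  rw [hom_chart, inCoordinates_eq_comp]
  rfl

theorem continuous_pt : Continuous (FrameBundle.pt : FrameBundle n M → M) :=
  (FiberBundle.continuous_proj _ _).comp continuous_subtype_val

theorem contMDiff_pt :
    ContMDiff (𝓘(ℝ, V n).prod 𝓘(ℝ, V n →L[ℝ] V n)) 𝓘(ℝ, V n) ∞
      (FrameBundle.pt : FrameBundle n M → M) :=
  (contMDiff_proj _).comp contMDiff_subtype_val

theorem contMDiffAt_frameCoord (u : FrameBundle n M) :
    ContMDiffAt (𝓘(ℝ, V n).prod 𝓘(ℝ, V n →L[ℝ] V n)) 𝓘(ℝ, V n →L[ℝ] V n) ∞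
      (frameCoord u.pt) u := by
  have h := (contMDiffAt_hom_bundle (n := ∞) (IM := 𝓘(ℝ, V n).prod 𝓘(ℝ, V n →L[ℝ] V n))
    (fun v : FrameBundle n M => v.1) (x₀ := u)).1 contMDiff_subtype_val.contMDiffAt
  exact h.2.congr_of_eventuallyEq (.of_forall fun v => (inCoordinates_eq_comp _ _ _).symm)

theorem contMDiffAt_frameBundle_iff {E H N : Type*} [NormedAddCommGroup E] [NormedSpace ℝ E]
    [TopologicalSpace H] {I : ModelWithCorners ℝ E H} [TopologicalSpace N] [ChartedSpace H N]
    {f : N → FrameBundle n M} {a : N} :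
    ContMDiffAt I (𝓘(ℝ, V n).prod 𝓘(ℝ, V n →L[ℝ] V n)) ∞ f a ↔
      ContMDiffAt I 𝓘(ℝ, V n) ∞ (fun b => (f b).pt) a ∧
      ContMDiffAt I 𝓘(ℝ, V n →L[ℝ] V n) ∞ (fun b => frameCoord (f a).pt (f b)) a := by
  rw [← ContMDiffAt.subtypeVal_comp_iff]
  refine (contMDiffAt_hom_bundle _).trans (and_congr Iff.rfl ?_)
  refine Filter.EventuallyEq.contMDiffAt_iff (.of_forall fun v => ?_)
  exact inCoordinates_eq_comp _ _ _

theorem continuous_mk_comp (A : V n →L[ℝ] V n) (hA : A.IsInvertible) :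
    Continuous fun u : FrameBundle n M =>
      FrameBundle.mk u.pt (u.map ∘L A) (ContinuousLinearMap.IsInvertible.comp u.2 hA) := by
  have h : ContMDiff (𝓘(ℝ, V n).prod 𝓘(ℝ, V n →L[ℝ] V n))
      (𝓘(ℝ, V n).prod 𝓘(ℝ, V n →L[ℝ] V n)) ∞ fun u : FrameBundle n M =>
      FrameBundle.mk u.pt (u.map ∘L A) (ContinuousLinearMap.IsInvertible.comp u.2 hA) := fun u =>
    contMDiffAt_frameBundle_iff.2 ⟨contMDiff_pt u,
      (contMDiffAt_frameCoord u).clm_comp (contMDiffAt_const (c := A))⟩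
  exact h.continuous

/-- It makes the projection `FM → FM/G` open. -/
instance (G : Subgroup (GL (Fin n) ℝ)) : ContinuousConstSMul G.op (FrameBundle n M) :=
  ⟨fun g => continuous_mk_comp (glHom g.1.unop) (glHom_isInvertible _)⟩

theorem isOpenQuotientMap_quot (G : Subgroup (GL (Fin n) ℝ)) :
    IsOpenQuotientMap (quot G : FrameBundle n M → FrameQuotient n M G) :=
  MulAction.isOpenQuotientMap_quotientMk

theorem map_quot_nhds (G : Subgroup (GL (Fin n) ℝ)) (u : FrameBundle n M) :
    Filter.map (quot G) (𝓝 u) = 𝓝 (quot G u) :=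
  (isOpenQuotientMap_quot G).map_nhds_eq u

/-! ### The derivative of a local diffeomorphism in coordinates -/

theorem tangentCoord_mfderiv {f : LocalDiffeo n M M'} {x : M} (hx : x ∈ f.source) :
    ∀ᶠ p in 𝓝 x, tangentCoord (f x) (f p) ∘L mfderiv 𝓘(ℝ, V n) 𝓘(ℝ, V n) f p =
      fderiv ℝ (writtenInExtChartAt 𝓘(ℝ, V n) 𝓘(ℝ, V n) x f) (extChartAt 𝓘(ℝ, V n) x p) ∘L
        tangentCoord x p := by
  have hfx : ContinuousAt f x := (f.contMDiffOn.continuousOn).continuousAt (f.open_source.mem_nhds hx)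
  filter_upwards [f.open_source.mem_nhds hx, (chartAt (V n) x).open_source.mem_nhds
    (mem_chart_source (V n) x), hfx ((chartAt (V n) (f x)).open_source.mem_nhds
    (mem_chart_source (V n) (f x)))] with p hp hpx hpy
  have hpx' : p ∈ (extChartAt 𝓘(ℝ, V n) x).source := by simpa using hpx
  have d1 : MDifferentiableAt 𝓘(ℝ, V n) 𝓘(ℝ, V n) f p := f.mdifferentiableAt (by simp) hp
  have d2 : MDifferentiableAt 𝓘(ℝ, V n) 𝓘(ℝ, V n) (extChartAt 𝓘(ℝ, V n) (f x)) (f p) :=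
    mdifferentiableAt_extChartAt hpy
  have d3 : MDifferentiableAt 𝓘(ℝ, V n) 𝓘(ℝ, V n) (extChartAt 𝓘(ℝ, V n) x) p :=
    mdifferentiableAt_extChartAt hpx
  have d4 : MDifferentiableAt 𝓘(ℝ, V n) 𝓘(ℝ, V n)
      (writtenInExtChartAt 𝓘(ℝ, V n) 𝓘(ℝ, V n) x f) (extChartAt 𝓘(ℝ, V n) x p) := by
    have h1 : MDifferentiableAt 𝓘(ℝ, V n) 𝓘(ℝ, V n) (extChartAt 𝓘(ℝ, V n) x).symm
        (extChartAt 𝓘(ℝ, V n) x p) := by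
      have := mdifferentiableWithinAt_extChartAt_symm (I := 𝓘(ℝ, V n))
        ((extChartAt 𝓘(ℝ, V n) x).map_source hpx')
      rwa [modelWithCornersSelf_coe, Set.range_id, mdifferentiableWithinAt_univ] at this
    have h2 := (extChartAt 𝓘(ℝ, V n) x).left_inv hpx'
    have d1' : MDifferentiableAt 𝓘(ℝ, V n) 𝓘(ℝ, V n) f
        ((extChartAt 𝓘(ℝ, V n) x).symm (extChartAt 𝓘(ℝ, V n) x p)) := by rwa [h2]
    have d2' : MDifferentiableAt 𝓘(ℝ, V n) 𝓘(ℝ, V n) (extChartAt 𝓘(ℝ, V n) (f x))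
        ((f ∘ (extChartAt 𝓘(ℝ, V n) x).symm) (extChartAt 𝓘(ℝ, V n) x p)) := by
      rwa [Function.comp_apply, h2]
    exact d2'.comp _ (d1'.comp _ h1)
  have e1 : tangentCoord (f x) (f p) =
      mfderiv 𝓘(ℝ, V n) 𝓘(ℝ, V n) (extChartAt 𝓘(ℝ, V n) (f x)) (f p) :=
    TangentBundle.continuousLinearMapAt_trivializationAt hpy
  have e2 : tangentCoord x p = mfderiv 𝓘(ℝ, V n) 𝓘(ℝ, V n) (extChartAt 𝓘(ℝ, V n) x) p :=
    TangentBundle.continuousLinearMapAt_trivializationAt hpx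
  rw [e1, e2, ← mfderiv_eq_fderiv]
  refine (mfderiv_comp p d2 d1).symm.trans (Eq.trans ?_ (mfderiv_comp p d4 d3))
  refine Filter.EventuallyEq.mfderiv_eq ?_
  filter_upwards [(chartAt (V n) x).open_source.mem_nhds hpx] with z hz
  simp only [Function.comp_apply, writtenInExtChartAt]
  rw [(extChartAt 𝓘(ℝ, V n) x).left_inv (by simpa using hz)]

/-- In charts `F` for `f`, the map induced on frames is `(z, B) ↦ (F z, DF(z) ∘ B)`. -/
theorem frameCoord_frameMap {f : LocalDiffeo n M M'} {x : M} (hx : x ∈ f.source) :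
    ∀ᶠ p in 𝓝 x, ∀ u : FrameBundle n M, u.pt = p → frameCoord (f x) (frameMap f u) =
      fderiv ℝ (writtenInExtChartAt 𝓘(ℝ, V n) 𝓘(ℝ, V n) x f) (extChartAt 𝓘(ℝ, V n) x p) ∘L
        frameCoord x u := by
  filter_upwards [tangentCoord_mfderiv hx, f.open_source.mem_nhds hx] with p hp hps u hu
  subst hu
  have e : frameMap f u = .mk (f u.pt) (mfderiv 𝓘(ℝ, V n) 𝓘(ℝ, V n) f u.pt ∘L u.map)
      (.comp (LocalDiffeo.mfderiv_isInvertible f hps) u.2) := dif_pos hps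
  rw [e]
  exact congrArg (· ∘L u.map) hp

theorem pt_frameMap (f : LocalDiffeo n M M') (u : FrameBundle n M) :
    (frameMap f u).pt = f u.pt := by
  by_cases h : u.pt ∈ f.source
  · simp only [frameMap, dif_pos h]; rfl
  · simp only [frameMap, dif_neg h]; rfl

theorem contMDiffAt_frameMap (f : LocalDiffeo n M M') {u : FrameBundle n M}
    (hu : u.pt ∈ f.source) :
    ContMDiffAt (𝓘(ℝ, V n).prod 𝓘(ℝ, V n →L[ℝ] V n)) (𝓘(ℝ, V n).prod 𝓘(ℝ, V n →L[ℝ] V n)) ∞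
      (frameMap f) u := by
  have hf : ContMDiffAt 𝓘(ℝ, V n) 𝓘(ℝ, V n) ∞ f u.pt :=
    f.contMDiffOn.contMDiffAt (f.open_source.mem_nhds hu)
  rw [contMDiffAt_frameBundle_iff]
  simp only [pt_frameMap]
  refine ⟨hf.comp u (contMDiff_pt u), ?_⟩
  have h1 : ContDiffAt ℝ ∞ (fderiv ℝ (writtenInExtChartAt 𝓘(ℝ, V n) 𝓘(ℝ, V n) u.pt f))
      (extChartAt 𝓘(ℝ, V n) u.pt u.pt) := (contDiffAt_written hf).fderiv_right (by simp)
  have h2 : ContMDiffAt (𝓘(ℝ, V n).prod 𝓘(ℝ, V n →L[ℝ] V n)) 𝓘(ℝ, V n) ∞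
      (fun v : FrameBundle n M => extChartAt 𝓘(ℝ, V n) u.pt v.pt) u :=
    ContMDiffAt.comp u (contMDiffAt_extChartAt (x := u.pt)) (contMDiff_pt u)
  have h3 := ContMDiffAt.comp u (h1.contMDiffAt) h2
  refine (h3.clm_comp (contMDiffAt_frameCoord u)).congr_of_eventuallyEq ?_
  filter_upwards [continuous_pt.continuousAt.eventually (frameCoord_frameMap hu)] with v hv
  exact hv v rfl

end FrameCoordinates

/-! ### Functoriality of the map induced on frames -/

section FrameMap

open Bundle Filter

variable {n : ℕ} {M : Type*} [TopologicalSpace M] [ChartedSpace (V n) M]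
  [IsManifold 𝓘(ℝ, V n) ∞ M]
  {M' : Type*} [TopologicalSpace M'] [ChartedSpace (V n) M'] [IsManifold 𝓘(ℝ, V n) ∞ M']
  {M'' : Type*} [TopologicalSpace M''] [ChartedSpace (V n) M''] [IsManifold 𝓘(ℝ, V n) ∞ M'']

theorem FrameBundle.ext_of_map_apply {u v : FrameBundle n M} (h : u.pt = v.pt)
    (h' : ∀ w, (u.map w : V n) = v.map w) : u = v := by
  obtain ⟨⟨p, A⟩, hA⟩ := u
  obtain ⟨⟨p', A'⟩, hA'⟩ := v
  obtain rfl : p = p' := h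
  obtain rfl : A = A' := ContinuousLinearMap.ext h'
  rfl

theorem frameMap_of_mem (f : LocalDiffeo n M M') {u : FrameBundle n M} (h : u.pt ∈ f.source) :
    frameMap f u = .mk (f u.pt) (mfderiv 𝓘(ℝ, V n) 𝓘(ℝ, V n) f u.pt ∘L u.map)
      (.comp (LocalDiffeo.mfderiv_isInvertible f h) u.2) := dif_pos h

theorem frameMap_frameMap {f : LocalDiffeo n M M'} {g : LocalDiffeo n M' M''}
    {u : FrameBundle n M} (hf : u.pt ∈ f.source) (hg : f u.pt ∈ g.source) :
    frameMap g (frameMap f u) = frameMap (f.trans g) u := by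
  have hfg : u.pt ∈ (f.trans g).source := ⟨hf, hg⟩
  have d : mfderiv 𝓘(ℝ, V n) 𝓘(ℝ, V n) (f.trans g) u.pt =
      (mfderiv 𝓘(ℝ, V n) 𝓘(ℝ, V n) g (f u.pt)).comp (mfderiv 𝓘(ℝ, V n) 𝓘(ℝ, V n) f u.pt) :=
    mfderiv_comp u.pt (g.mdifferentiableAt (by simp) hg) (f.mdifferentiableAt (by simp) hf)
  have hg' : (FrameBundle.mk (f u.pt) (mfderiv 𝓘(ℝ, V n) 𝓘(ℝ, V n) f u.pt ∘L u.map)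
      (.comp (LocalDiffeo.mfderiv_isInvertible f hf) u.2)).pt ∈ g.source := hg
  rw [frameMap_of_mem _ hf, frameMap_of_mem _ hfg, frameMap_of_mem _ hg']
  refine FrameBundle.ext_of_map_apply rfl fun w => ?_
  exact (DFunLike.congr_fun d (u.map w)).symm

theorem frameMap_eq_self {f : LocalDiffeo n M M} {u : FrameBundle n M} (hu : u.pt ∈ f.source)
    (h : f =ᶠ[𝓝 u.pt] id) : frameMap f u = u := by
  rw [frameMap_of_mem _ hu]
  refine FrameBundle.ext_of_map_apply h.eq_of_nhds fun w => ?_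
  change mfderiv 𝓘(ℝ, V n) 𝓘(ℝ, V n) f u.pt (u.map w) = u.map w
  rw [h.mfderiv_eq, mfderiv_id]
  rfl

theorem FrameBundle.ext_of_frameCoord {u v : FrameBundle n M} (h : u.pt = v.pt)
    (h' : frameCoord u.pt u = frameCoord u.pt v) : u = v := by
  obtain ⟨⟨p, A⟩, hA⟩ := u
  obtain ⟨⟨p', A'⟩, hA'⟩ := v
  obtain rfl : p = p' := h
  refine FrameBundle.ext_of_map_apply rfl fun w => ?_
  have hinv : ∀ z, (trivializationAt (V n) (TangentSpace 𝓘(ℝ, V n)) p).symmL ℝ p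
      (tangentCoord p p z) = z :=
    (trivializationAt (V n) (TangentSpace 𝓘(ℝ, V n)) p).symmL_continuousLinearMapAt
      (FiberBundle.mem_baseSet_trivializationAt' p)
  have hw : tangentCoord p p (A w) = tangentCoord p p (A' w) := DFunLike.congr_fun h' w
  change A w = A' w
  rw [← hinv (A w), hw, hinv]

theorem frameMap_eq_of_jetEq {f f' : LocalDiffeo n M M'} {u : FrameBundle n M}
    (hf : u.pt ∈ f.source) (hf' : u.pt ∈ f'.source) {r : ℕ}
    (h : JetEq (V n) (V n) (r + 1) u.pt f f') : frameMap f u = frameMap f' u := by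
  have h1 := (frameCoord_frameMap hf).self_of_nhds u rfl
  have h2 := (frameCoord_frameMap hf').self_of_nhds u rfl
  have h3 : fderiv ℝ (writtenInExtChartAt 𝓘(ℝ, V n) 𝓘(ℝ, V n) u.pt f)
      (extChartAt 𝓘(ℝ, V n) u.pt u.pt) = fderiv ℝ (writtenInExtChartAt 𝓘(ℝ, V n) 𝓘(ℝ, V n) u.pt f')
      (extChartAt 𝓘(ℝ, V n) u.pt u.pt) := by
    ext1 v
    have := congrArg (fun A => A fun _ => v) (h.2 1 (by omega))
    simpa only [iteratedFDeriv_one_apply] using this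
  rw [h3, ← h2, ← h.1] at h1
  have hp : (frameMap f u).pt = (frameMap f' u).pt := by rw [pt_frameMap, pt_frameMap, h.1]
  refine FrameBundle.ext_of_frameCoord hp ?_
  rwa [pt_frameMap]

end FrameMap

/-! ### The induced map of `FM/G` and the direct image of local sections -/

section Quotient

open Filter

variable {n : ℕ} {M : Type*} [TopologicalSpace M] [ChartedSpace (V n) M]
  [IsManifold 𝓘(ℝ, V n) ∞ M]
  {M' : Type*} [TopologicalSpace M'] [ChartedSpace (V n) M'] [IsManifold 𝓘(ℝ, V n) ∞ M']
  {M'' : Type*} [TopologicalSpace M''] [ChartedSpace (V n) M''] [IsManifold 𝓘(ℝ, V n) ∞ M'']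
  {G : Subgroup (GL (Fin n) ℝ)}

theorem quot_surjective (w : FrameQuotient n M G) : ∃ u, quot G u = w :=
  (isOpenQuotientMap_quot G).surjective w

theorem quotMap_quot (f : LocalDiffeo n M M') (u : FrameBundle n M) :
    quotMap f (quot G u) = quot G (frameMap f u) := rfl

theorem pt_quot (u : FrameBundle n M) : (quot G u).pt = u.pt := rfl

theorem pt_quotMap (f : LocalDiffeo n M M') (w : FrameQuotient n M G) :
    (quotMap f w).pt = f w.pt := by
  obtain ⟨u, rfl⟩ := quot_surjective w
  rw [quotMap_quot, pt_quot, pt_quot, pt_frameMap]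

theorem continuous_quotient_pt : Continuous (FrameQuotient.pt : FrameQuotient n M G → M) :=
  (isOpenQuotientMap_quot G).isQuotientMap.continuous_iff.2 continuous_pt

theorem continuousOn_quotMap (f : LocalDiffeo n M M') :
    ContinuousOn (quotMap f : FrameQuotient n M G → FrameQuotient n M' G)
      (FrameQuotient.pt ⁻¹' f.source) := by
  intro w hw
  obtain ⟨u, rfl⟩ := quot_surjective w
  refine ContinuousAt.continuousWithinAt ?_
  rw [ContinuousAt, ← map_quot_nhds, tendsto_map'_iff]
  exact (isOpenQuotientMap_quot G).continuous.continuousAt.comp (contMDiffAt_frameMap f hw).continuousAt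

theorem isOpen_quotMap_preimage (f : LocalDiffeo n M M') {W : Set (FrameQuotient n M' G)}
    (hW : IsOpen W) : IsOpen ((FrameQuotient.pt : FrameQuotient n M G → M) ⁻¹' f.source ∩
      quotMap f ⁻¹' W) :=
  (continuousOn_quotMap f).isOpen_inter_preimage (f.open_source.preimage continuous_quotient_pt) hW

theorem IsSmoothFun.contMDiffAt {W : Set (FrameQuotient n M G)} {h : FrameQuotient n M G → ℝ}
    (hh : IsSmoothFun W h) {u : FrameBundle n M} (hu : quot G u ∈ W) :
    ContMDiffAt (𝓘(ℝ, V n).prod 𝓘(ℝ, V n →L[ℝ] V n)) 𝓘(ℝ, ℝ) ∞ (fun u => h (quot G u)) u :=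
  hh.2.contMDiffAt ((hh.1.preimage (isOpenQuotientMap_quot G).continuous).mem_nhds hu)

theorem IsSmoothFun.comp_quotMap (f : LocalDiffeo n M M') {W : Set (FrameQuotient n M' G)}
    {h : FrameQuotient n M' G → ℝ} (hh : IsSmoothFun W h) :
    IsSmoothFun ((FrameQuotient.pt : FrameQuotient n M G → M) ⁻¹' f.source ∩ quotMap f ⁻¹' W)
      (fun w => h (quotMap f w)) := by
  refine ⟨isOpen_quotMap_preimage f hh.1, fun u hu => ?_⟩
  exact ((hh.contMDiffAt (u := frameMap f u) hu.2).comp u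
    (contMDiffAt_frameMap f hu.1)).contMDiffWithinAt

theorem LocalSection.contMDiffAt {x : M} (s : LocalSection G x) {W : Set (FrameQuotient n M G)}
    {h : FrameQuotient n M G → ℝ} (hh : IsSmoothFun W h) (hx : s.toFun x ∈ W) :
    ContMDiffAt 𝓘(ℝ, V n) 𝓘(ℝ, ℝ) ∞ (fun y => h (s.toFun y)) x :=
  (s.smooth.2 W h hh).contMDiffAt
    ((s.smooth.1.isOpen_inter_preimage s.isOpen_dom hh.1).mem_nhds ⟨s.mem_dom, hx⟩)

theorem LocalSection.continuousAt {x : M} (s : LocalSection G x) : ContinuousAt s.toFun x :=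
  s.smooth.1.continuousAt (s.isOpen_dom.mem_nhds s.mem_dom)

theorem quotMap_quotMap {f : LocalDiffeo n M M'} {g : LocalDiffeo n M' M''}
    {w : FrameQuotient n M G} (hf : w.pt ∈ f.source) (hg : f w.pt ∈ g.source) :
    quotMap g (quotMap f w) = quotMap (f.trans g) w := by
  obtain ⟨u, rfl⟩ := quot_surjective w
  rw [quotMap_quot, quotMap_quot, quotMap_quot, frameMap_frameMap hf hg]

theorem quotMap_eq_self {f : LocalDiffeo n M M} {w : FrameQuotient n M G} (hw : w.pt ∈ f.source)
    (h : f =ᶠ[𝓝 w.pt] id) : quotMap f w = w := by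
  obtain ⟨u, rfl⟩ := quot_surjective w
  rw [quotMap_quot, frameMap_eq_self hw h]

/-- The local section `f · s` of `FM'/G`, with its domain `f(dom s)`. -/
def LocalSection.pushforward {x : M} {y : M'} (f : LocalDiffeoAt n x y) (s : LocalSection G x) :
    LocalSection G y where
  dom := f.toDiffeo.target ∩ f.toDiffeo.symm ⁻¹' s.dom
  isOpen_dom := f.toDiffeo.symm.contMDiffOn.continuousOn.isOpen_inter_preimage
    f.toDiffeo.open_target s.isOpen_dom
  mem_dom := ⟨f.mem_target, (congrArg (· ∈ s.dom) f.symm.map_eq).mpr s.mem_dom⟩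
  toFun := GJet.pushforward f.toDiffeo s.toFun
  pt_toFun z hz := by
    rw [GJet.pushforward, pt_quotMap, s.pt_toFun _ hz.2]
    exact f.toDiffeo.right_inv hz.1
  smooth := by
    have hsrc : ∀ z ∈ f.toDiffeo.target ∩ f.toDiffeo.symm ⁻¹' s.dom,
        (s.toFun (f.toDiffeo.symm z)).pt ∈ f.toDiffeo.source := fun z hz => by
      rw [s.pt_toFun _ hz.2]
      exact f.toDiffeo.symm.map_source hz.1
    refine ⟨?_, fun W h hh => ?_⟩
    · exact (continuousOn_quotMap f.toDiffeo).comp (s.smooth.1.comp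
        (f.toDiffeo.symm.contMDiffOn.continuousOn.mono Set.inter_subset_left)
        fun z hz => hz.2) hsrc
    · refine (s.smooth.2 _ _ (hh.comp_quotMap f.toDiffeo)).comp
        (f.toDiffeo.symm.contMDiffOn.mono fun z hz => hz.1.1) fun z hz => ?_
      exact ⟨hz.1.2, hsrc z hz.1, hz.2⟩

end Quotient

/-! ### Jets of real functions and orders of vanishing of their difference -/

section Estimates

open Filter Asymptotics

variable {E F : Type*} [NormedAddCommGroup E] [NormedSpace ℝ E] [NormedAddCommGroup F]
  [NormedSpace ℝ F]

theorem iteratedFDeriv_sub_of_contDiffAt {f g : E → F} {x : E} {k : ℕ} (hf : ContDiffAt ℝ ∞ f x)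
    (hg : ContDiffAt ℝ ∞ g x) :
    iteratedFDeriv ℝ k (f - g) x = iteratedFDeriv ℝ k f x - iteratedFDeriv ℝ k g x :=
  iteratedFDeriv_sub_apply (hf.of_le (by exact_mod_cast le_top))
    (hg.of_le (by exact_mod_cast le_top))

theorem iteratedFDeriv_sub_eq_zero {f g : E → F} {x : E} {k : ℕ} (hf : ContDiffAt ℝ ∞ f x)
    (hg : ContDiffAt ℝ ∞ g x) (h : iteratedFDeriv ℝ k f x = iteratedFDeriv ℝ k g x) :
    iteratedFDeriv ℝ k (f - g) x = 0 := by
  rw [iteratedFDeriv_sub_of_contDiffAt hf hg, h, sub_self]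

theorem isBigO_sub_of_iteratedFDeriv_eq [CompleteSpace F] {f g : E → F} {x : E} {r : ℕ}
    (hf : ContDiffAt ℝ ∞ f x) (hg : ContDiffAt ℝ ∞ g x)
    (h : ∀ k ≤ r, iteratedFDeriv ℝ k f x = iteratedFDeriv ℝ k g x) :
    (fun z => f z - g z) =O[𝓝 x] fun z => ‖z - x‖ ^ (r + 1) :=
  isBigO_of_iteratedFDeriv_eq_zero (hf.sub hg) fun k hk =>
    iteratedFDeriv_sub_eq_zero hf hg (h k hk)

theorem isBigO_fderiv_sub_of_iteratedFDeriv_eq [CompleteSpace F] {f g : E → F} {x : E} {r : ℕ}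
    (hf : ContDiffAt ℝ ∞ f x) (hg : ContDiffAt ℝ ∞ g x)
    (h : ∀ k ≤ r + 1, iteratedFDeriv ℝ k f x = iteratedFDeriv ℝ k g x) :
    (fun z => fderiv ℝ f z - fderiv ℝ g z) =O[𝓝 x] fun z => ‖z - x‖ ^ (r + 1) := by
  have hd : ∀ {f : E → F}, ContDiffAt ℝ ∞ f x → ∀ᶠ z in 𝓝 x, DifferentiableAt ℝ f z := by
    intro f hf
    filter_upwards [(hf.of_le (m := 1) (by exact_mod_cast le_top)).eventually (by simp)] with z hz
    exact hz.differentiableAt one_ne_zero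
  have h1 : fderiv ℝ (f - g) =O[𝓝 x] fun z => ‖z - x‖ ^ (r + 1) := by
    refine isBigO_of_iteratedFDeriv_eq_zero ((hf.sub hg).fderiv_right (by simp)) fun k hk => ?_
    rw [← norm_eq_zero, norm_iteratedFDeriv_fderiv, norm_eq_zero]
    exact iteratedFDeriv_sub_eq_zero hf hg (h (k + 1) (by omega))
  refine h1.congr' ?_ .rfl
  filter_upwards [hd hf, hd hg] with z hz hz'
  exact fderiv_sub hz hz'

theorem jetEq_of_isBigO_sub {M : Type*} [TopologicalSpace M] [ChartedSpace E M] {x : M}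
    {φ ψ : M → ℝ} {r : ℕ} (hφ : ContMDiffAt 𝓘(ℝ, E) 𝓘(ℝ, ℝ) ∞ φ x)
    (hψ : ContMDiffAt 𝓘(ℝ, E) 𝓘(ℝ, ℝ) ∞ ψ x)
    (h : (fun p => φ p - ψ p) =O[𝓝 x]
      fun p => ‖extChartAt 𝓘(ℝ, E) x p - extChartAt 𝓘(ℝ, E) x x‖ ^ (r + 1)) :
    JetEq E ℝ r x φ ψ := by
  have hx : φ x = ψ x := by
    obtain ⟨C, hC⟩ := h.bound
    have := hC.self_of_nhds
    rw [sub_self, norm_zero, zero_pow r.succ_ne_zero, norm_zero, mul_zero, norm_le_zero_iff] at this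
    exact sub_eq_zero.1 this
  have ht : Tendsto (extChartAt 𝓘(ℝ, E) x).symm (𝓝 (extChartAt 𝓘(ℝ, E) x x)) (𝓝 x) := by
    have := continuousAt_extChartAt_symm (I := 𝓘(ℝ, E)) x
    rwa [ContinuousAt, extChartAt_to_inv] at this
  have h1 : (writtenInExtChartAt 𝓘(ℝ, E) 𝓘(ℝ, ℝ) x φ - writtenInExtChartAt 𝓘(ℝ, E) 𝓘(ℝ, ℝ) x ψ)
      =O[𝓝 (extChartAt 𝓘(ℝ, E) x x)] fun z => ‖z - extChartAt 𝓘(ℝ, E) x x‖ ^ (r + 1) := by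
    refine (h.comp_tendsto ht).congr' (.of_forall fun z => ?_) ?_
    · simp only [writtenInExtChartAt, Function.comp_apply, Pi.sub_apply,
        extChartAt_model_space_eq_id, PartialEquiv.refl_coe, id]
    · filter_upwards [extChartAt_target_mem_nhds (I := 𝓘(ℝ, E)) x] with z hz
      simp only [Function.comp_apply]
      rw [(extChartAt 𝓘(ℝ, E) x).right_inv hz]
  have hφ' := contDiffAt_written hφ
  have hψ' := contDiffAt_written hψ
  refine ⟨hx, fun k hk => ?_⟩
  have h2 := iteratedFDeriv_eq_zero_of_isBigO (hφ'.sub hψ') h1 k hk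
  exact sub_eq_zero.1 ((iteratedFDeriv_sub_of_contDiffAt hφ' hψ').symm.trans h2)

/-- A smooth function on a manifold is Lipschitz near each point, with respect to a chart. -/
theorem isBigO_sub_of_contMDiffAt {H N : Type*} [TopologicalSpace H] {I : ModelWithCorners ℝ E H}
    [I.Boundaryless] [TopologicalSpace N] [ChartedSpace H N] {ψ : N → ℝ} {v : N}
    (hψ : ContMDiffAt I 𝓘(ℝ, ℝ) ∞ ψ v) :
    (fun p : N × N => ψ p.1 - ψ p.2) =O[𝓝 (v, v)]
      fun p => extChartAt I v p.1 - extChartAt I v p.2 := by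
  have h1 : ContDiffAt ℝ ∞ (ψ ∘ (extChartAt I v).symm) (extChartAt I v v) := by
    have := (contMDiffAt_iff.1 hψ).2
    rwa [I.range_eq_univ, contDiffWithinAt_univ, extChartAt_model_space_eq_id] at this
  have h2 := (h1.hasStrictFDerivAt (by simp)).isBigO_sub
  have hc := (continuousAt_extChartAt (I := I) v).tendsto
  refine (h2.comp_tendsto (hc.prodMap_nhds hc)).congr' ?_ .rfl
  have hs := extChartAt_source_mem_nhds (I := I) v
  filter_upwards [prod_mem_nhds hs hs] with p hp
  simp only [Function.comp_apply, Prod.map_fst, Prod.map_snd]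
  rw [(extChartAt I v).left_inv hp.1, (extChartAt I v).left_inv hp.2]

end Estimates

/-! ### Dependence of the direct image on jets -/

section WellDefined

open Filter Asymptotics

variable {n r : ℕ} {M : Type*} [TopologicalSpace M] [ChartedSpace (V n) M]
  [IsManifold 𝓘(ℝ, V n) ∞ M]
  {M' : Type*} [TopologicalSpace M'] [ChartedSpace (V n) M'] [IsManifold 𝓘(ℝ, V n) ∞ M']
  {G : Subgroup (GL (Fin n) ℝ)}

/-- One derivative is lost in passing from `f` to the map it induces on frames: if `f` and `f'` have
the same `(r+1)`-jet at a point, the induced maps differ by `O(|z|^{r+1})` near each frame over this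
point, where `z` is the coordinate of the base point only. -/
theorem isBigO_extChartAt_frameMap_sub {f f' : LocalDiffeo n M M'} {u₀ : FrameBundle n M}
    (hf : u₀.pt ∈ f.source) (hf' : u₀.pt ∈ f'.source)
    (h : JetEq (V n) (V n) (r + 1) u₀.pt f f') :
    (fun u => extChartAt (𝓘(ℝ, V n).prod 𝓘(ℝ, V n →L[ℝ] V n)) (frameMap f u₀) (frameMap f u) -
      extChartAt (𝓘(ℝ, V n).prod 𝓘(ℝ, V n →L[ℝ] V n)) (frameMap f u₀) (frameMap f' u)) =O[𝓝 u₀]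
      fun u => ‖extChartAt 𝓘(ℝ, V n) u₀.pt u.pt - extChartAt 𝓘(ℝ, V n) u₀.pt u₀.pt‖ ^ (r + 1) := by
  have hs : ∀ {f : LocalDiffeo n M M'}, u₀.pt ∈ f.source →
      ContDiffAt ℝ ∞ (writtenInExtChartAt 𝓘(ℝ, V n) 𝓘(ℝ, V n) u₀.pt f)
        (extChartAt 𝓘(ℝ, V n) u₀.pt u₀.pt) := fun {f} hf =>
    contDiffAt_written (f.contMDiffOn.contMDiffAt (f.open_source.mem_nhds hf))
  have ht : Tendsto (fun u : FrameBundle n M => extChartAt 𝓘(ℝ, V n) u₀.pt u.pt) (𝓝 u₀)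
      (𝓝 (extChartAt 𝓘(ℝ, V n) u₀.pt u₀.pt)) :=
    (continuousAt_extChartAt (I := 𝓘(ℝ, V n)) u₀.pt).tendsto.comp continuous_pt.continuousAt
  have h1 := (isBigO_sub_of_iteratedFDeriv_eq (hs hf) (hs hf')
    fun k hk => h.2 k (hk.trans r.le_succ)).comp_tendsto ht
  have h2 := (isBigO_fderiv_sub_of_iteratedFDeriv_eq (hs hf) (hs hf') h.2).comp_tendsto ht
  -- the linear part of the frame is bounded near `u₀`
  have hB : frameCoord u₀.pt =O[𝓝 u₀] fun _ => (1 : ℝ) :=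
    (contMDiffAt_frameCoord u₀).continuousAt.isBigO_one ℝ
  have h3 : (fun u : FrameBundle n M =>
      (fderiv ℝ (writtenInExtChartAt 𝓘(ℝ, V n) 𝓘(ℝ, V n) u₀.pt f)
        (extChartAt 𝓘(ℝ, V n) u₀.pt u.pt) -
      fderiv ℝ (writtenInExtChartAt 𝓘(ℝ, V n) 𝓘(ℝ, V n) u₀.pt f')
        (extChartAt 𝓘(ℝ, V n) u₀.pt u.pt)) ∘L frameCoord u₀.pt u) =O[𝓝 u₀]
      fun u => ‖extChartAt 𝓘(ℝ, V n) u₀.pt u.pt - extChartAt 𝓘(ℝ, V n) u₀.pt u₀.pt‖ ^ (r + 1) := by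
    refine (IsBigO.of_bound 1 (.of_forall fun u => ?_)).trans
      ((h2.norm_left.mul hB.norm_left).congr_right fun u => mul_one _)
    rw [one_mul, norm_mul, norm_norm, norm_norm]
    exact ContinuousLinearMap.opNorm_comp_le _ _
  refine (h1.prod_left h3).congr' ?_ .rfl
  have hev := fun {f : LocalDiffeo n M M'} (hf : u₀.pt ∈ f.source) =>
    continuous_pt.continuousAt.eventually (frameCoord_frameMap (x := u₀.pt) hf)
  filter_upwards [hev hf, hev hf', continuous_pt.continuousAt.eventually
    (extChartAt_source_mem_nhds (I := 𝓘(ℝ, V n)) u₀.pt)] with u hu hu' hus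
  rw [extChartAt_frameBundle, extChartAt_frameBundle, pt_frameMap, pt_frameMap, pt_frameMap,
    hu u rfl, h.1, hu' u rfl, Prod.mk_sub_mk, ContinuousLinearMap.sub_comp]
  simp only [Function.comp_apply, writtenInExtChartAt, h.1]
  rw [(extChartAt 𝓘(ℝ, V n) u₀.pt).left_inv hus]

/-- The estimate descends to `FM/G` because it only involves base points and the projection
`FM → FM/G` is open. No local section of this projection is needed. -/
theorem isBigO_comp_quotMap_sub {f f' : LocalDiffeo n M M'} {w₀ : FrameQuotient n M G}
    (hf : w₀.pt ∈ f.source) (hf' : w₀.pt ∈ f'.source)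
    (h : JetEq (V n) (V n) (r + 1) w₀.pt f f') {W : Set (FrameQuotient n M' G)}
    {φ : FrameQuotient n M' G → ℝ} (hφ : IsSmoothFun W φ) (hw : quotMap f w₀ ∈ W) :
    (fun w => φ (quotMap f w) - φ (quotMap f' w)) =O[𝓝 w₀]
      fun w => ‖extChartAt 𝓘(ℝ, V n) w₀.pt w.pt - extChartAt 𝓘(ℝ, V n) w₀.pt w₀.pt‖ ^ (r + 1) := by
  obtain ⟨u₀, rfl⟩ := quot_surjective w₀
  rw [← map_quot_nhds, isBigO_map]
  refine IsBigO.trans ?_ (isBigO_extChartAt_frameMap_sub hf hf' h)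
  have hv : frameMap f' u₀ = frameMap f u₀ := (frameMap_eq_of_jetEq hf hf' h).symm
  set v₀ := frameMap f u₀ with hv₀
  have hc : Tendsto (fun u => (frameMap f u, frameMap f' u)) (𝓝 u₀) (𝓝 (v₀, v₀)) := by
    refine (contMDiffAt_frameMap f hf).continuousAt.tendsto.prodMk_nhds ?_
    have := (contMDiffAt_frameMap f' hf').continuousAt.tendsto
    rwa [hv] at this
  exact (isBigO_sub_of_contMDiffAt (hφ.contMDiffAt (u := v₀) hw)).comp_tendsto hc

theorem quotMap_eq_of_jetEq {f f' : LocalDiffeo n M M'} {w : FrameQuotient n M G}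
    (hf : w.pt ∈ f.source) (hf' : w.pt ∈ f'.source)
    (h : JetEq (V n) (V n) (r + 1) w.pt f f') : quotMap f w = quotMap f' w := by
  obtain ⟨u, rfl⟩ := quot_surjective w
  rw [quotMap_quot, quotMap_quot, frameMap_eq_of_jetEq hf hf' h]

/-- Independence of the diffeomorphism: `φ ∘ f̃ ∘ s` and `φ ∘ f̃' ∘ s` differ by `O(|z|^{r+1})`, since
`s` is continuous and `s p` lies over `p`. -/
theorem jetEq_comp_quotMap {x : M} {f f' : LocalDiffeo n M M'} (hf : x ∈ f.source)
    (hf' : x ∈ f'.source) (h : JetEq (V n) (V n) (r + 1) x f f') (s : LocalSection G x)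
    {W : Set (FrameQuotient n M' G)} {φ : FrameQuotient n M' G → ℝ} (hφ : IsSmoothFun W φ)
    (hw : quotMap f (s.toFun x) ∈ W) :
    JetEq (V n) ℝ r x (fun p => φ (quotMap f (s.toFun p))) fun p => φ (quotMap f' (s.toFun p)) := by
  have hpt : (s.toFun x).pt = x := s.pt_toFun x s.mem_dom
  have hw' : quotMap f' (s.toFun x) ∈ W := by
    rwa [← quotMap_eq_of_jetEq (f := f) (r := r) (by rwa [hpt]) (by rwa [hpt]) (by rwa [hpt])]
  refine jetEq_of_isBigO_sub
    (s.contMDiffAt (hφ.comp_quotMap f) ⟨by rwa [Set.mem_preimage, hpt], hw⟩)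
    (s.contMDiffAt (hφ.comp_quotMap f') ⟨by rwa [Set.mem_preimage, hpt], hw'⟩) ?_
  have h1 := (isBigO_comp_quotMap_sub (f := f) (f' := f') (by rwa [hpt]) (by rwa [hpt])
    (by rwa [hpt]) hφ hw).comp_tendsto s.continuousAt.tendsto
  rw [hpt] at h1
  refine h1.congr' .rfl ?_
  filter_upwards [s.isOpen_dom.mem_nhds s.mem_dom] with p hp
  simp only [Function.comp_apply, s.pt_toFun p hp]

theorem JetEq.mono {E E' : Type*} [NormedAddCommGroup E] [NormedSpace ℝ E]
    [NormedAddCommGroup E'] [NormedSpace ℝ E'] {N : Type*} [TopologicalSpace N] [ChartedSpace E N]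
    {N' : Type*} [TopologicalSpace N'] [ChartedSpace E' N'] {k l : ℕ} {x : N} {f g : N → N'}
    (h : JetEq E E' l x f g) (hkl : k ≤ l) : JetEq E E' k x f g :=
  ⟨h.1, fun j hj => h.2 j (hj.trans hkl)⟩

theorem LocalSection.pt_mem {x : M} (s : LocalSection G x) {U : Set M} (hx : x ∈ U) :
    (s.toFun x).pt ∈ U :=
  (congrArg (· ∈ U) (s.pt_toFun x s.mem_dom)).mpr hx

theorem LocalSection.pushforward_apply {x : M} {y : M'} (f : LocalDiffeoAt n x y)
    (s : LocalSection G x) : (s.pushforward f).toFun y = quotMap f.toDiffeo (s.toFun x) :=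
  congrArg (fun p => quotMap f.toDiffeo (s.toFun p)) f.symm.map_eq

/-- The jet `j^r (f · s)` is determined by the jets `j^{r+1} f` and `j^r s`. -/
theorem sectionJet_pushforward_eq {x : M} {y : M'} {f f' : LocalDiffeoAt n x y}
    {s s' : LocalSection G x} (hf : JetEq (V n) (V n) (r + 1) x f.toDiffeo f'.toDiffeo)
    (hs : SectionJet.mk r s = SectionJet.mk r s') :
    SectionJet.mk r (s.pushforward f) = SectionJet.mk r (s'.pushforward f') := by
  have hs' : (sectionJetSetoid G r x).r s s' := Quotient.exact hs
  have hpt : (s.toFun x).pt = x := s.pt_toFun x s.mem_dom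
  have hv : quotMap f.toDiffeo (s.toFun x) = quotMap f'.toDiffeo (s.toFun x) :=
    quotMap_eq_of_jetEq (r := r) (s.pt_mem f.mem_source) (s.pt_mem f'.mem_source) (by rwa [hpt])
  refine Quotient.sound ⟨?_, fun W φ hφ hW => ?_⟩
  · rw [LocalSection.pushforward_apply, LocalSection.pushforward_apply, ← hs'.1, hv]
  rw [LocalSection.pushforward_apply] at hW
  have hW' : quotMap f'.toDiffeo (s.toFun x) ∈ W := hv ▸ hW
  have h1 := (jetEq_comp_quotMap f.mem_source f'.mem_source hf s hφ hW).trans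
    (hs'.2 _ _ (hφ.comp_quotMap f'.toDiffeo) ⟨s.pt_mem f'.mem_source, hW'⟩)
  have c1 := s.contMDiffAt (hφ.comp_quotMap f.toDiffeo) ⟨s.pt_mem f.mem_source, hW⟩
  have c2 := s'.contMDiffAt (hφ.comp_quotMap f'.toDiffeo) ⟨s'.pt_mem f'.mem_source, hs'.1 ▸ hW'⟩
  have hy : f.symm.toDiffeo y = x := f.symm.map_eq
  exact JetEq.comp (f := f.symm.toDiffeo) (f' := f'.symm.toDiffeo)
    (g := fun p => φ (quotMap f.toDiffeo (s.toFun p)))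
    (g' := fun p => φ (quotMap f'.toDiffeo (s'.toFun p)))
    f.symm.contMDiffAt f'.symm.contMDiffAt (hy.symm ▸ c1) (hy.symm ▸ c2)
    ((InvJet.inv_aux hf).mono r.le_succ) (hy.symm ▸ h1)

end WellDefined

/-! ### The action on jets and the moduli space -/

section Action

open Filter

variable {n r : ℕ} {M : Type*} [TopologicalSpace M] [ChartedSpace (V n) M]
  [IsManifold 𝓘(ℝ, V n) ∞ M]
  {M' : Type*} [TopologicalSpace M'] [ChartedSpace (V n) M'] [IsManifold 𝓘(ℝ, V n) ∞ M']
  {M'' : Type*} [TopologicalSpace M''] [ChartedSpace (V n) M''] [IsManifold 𝓘(ℝ, V n) ∞ M'']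
  {G : Subgroup (GL (Fin n) ℝ)}

theorem SectionJet.mk_eq_of_eventuallyEq {x : M} {s t : LocalSection G x}
    (h : s.toFun =ᶠ[𝓝 x] t.toFun) : SectionJet.mk r s = SectionJet.mk r t :=
  Quotient.sound ⟨h.eq_of_nhds, fun _ φ _ _ => .of_eventuallyEq (h.fun_comp φ)⟩

theorem LocalSection.pushforward_refl {x : M} (s : LocalSection G x) :
    (s.pushforward (.refl x)).toFun =ᶠ[𝓝 x] s.toFun := by
  refine .of_forall fun p => ?_
  exact quotMap_eq_self (f := (LocalDiffeoAt.refl (n := n) x).toDiffeo) (Set.mem_univ _) .rfl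

theorem LocalSection.pushforward_comp {x : M} {y : M'} {z : M''} (g : LocalDiffeoAt n y z)
    (f : LocalDiffeoAt n x y) (s : LocalSection G x) :
    ((s.pushforward f).pushforward g).toFun =ᶠ[𝓝 z] (s.pushforward (g.comp f)).toFun := by
  filter_upwards [((s.pushforward f).pushforward g).isOpen_dom.mem_nhds
    ((s.pushforward f).pushforward g).mem_dom] with p hp
  obtain ⟨hp1, hp2, hp3⟩ := hp
  have hpt : (s.toFun (f.toDiffeo.symm (g.toDiffeo.symm p))).pt =
      f.toDiffeo.symm (g.toDiffeo.symm p) := s.pt_toFun _ hp3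
  refine quotMap_quotMap (f := f.toDiffeo) (g := g.toDiffeo) ?_ ?_
  · rw [hpt]
    exact f.toDiffeo.symm.map_source hp2
  · rw [hpt]
    exact (congrArg (· ∈ g.toDiffeo.source) (f.toDiffeo.right_inv hp2)).mpr
      (g.toDiffeo.symm.map_source hp1)

/-- The jet `(j^{r+1} f) · (j^r s) = j^r (f · s)`. -/
def InvJet.translate {x : M} {y : M'} (α : InvJet n (r + 1) x y) (j : SectionJet G r x) :
    SectionJet G r y :=
  Quotient.liftOn₂ α j (fun f s => SectionJet.mk r (s.pushforward f))
    fun _ _ _ _ hf hs => sectionJet_pushforward_eq hf (Quotient.sound hs)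

theorem isTranslate_iff {x : M} {y : M'} {α : InvJet n (r + 1) x y} {j : SectionJet G r x}
    {j' : SectionJet G r y} : IsTranslate α j j' ↔ α.translate j = j' := by
  constructor
  · rintro ⟨f, s, s', rfl, rfl, h, rfl⟩
    exact SectionJet.mk_eq_of_eventuallyEq h.symm
  · rintro rfl
    obtain ⟨f, rfl⟩ := Quotient.exists_rep α
    obtain ⟨s, rfl⟩ := Quotient.exists_rep j
    exact ⟨f, s, s.pushforward f, rfl, rfl, .rfl, rfl⟩

theorem InvJet.translate_refl {x : M} (j : SectionJet G r x) :
    (InvJet.mk (r + 1) (.refl x)).translate j = j := by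
  obtain ⟨s, rfl⟩ := Quotient.exists_rep j
  exact SectionJet.mk_eq_of_eventuallyEq s.pushforward_refl

theorem InvJet.translate_comp {x : M} {y : M'} {z : M''} (β : InvJet n (r + 1) y z)
    (α : InvJet n (r + 1) x y) (j : SectionJet G r x) :
    (β.comp α).translate j = β.translate (α.translate j) := by
  obtain ⟨g, rfl⟩ := Quotient.exists_rep β
  obtain ⟨f, rfl⟩ := Quotient.exists_rep α
  obtain ⟨s, rfl⟩ := Quotient.exists_rep j
  exact (SectionJet.mk_eq_of_eventuallyEq (s.pushforward_comp g f)).symm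

theorem InvJet.translate_inv_translate {x : M} {y : M'} (α : InvJet n (r + 1) x y)
    (j : SectionJet G r x) : α.inv.translate (α.translate j) = j := by
  rw [← translate_comp]
  obtain ⟨f, rfl⟩ := Quotient.exists_rep α
  exact (congrArg (InvJet.translate · j) (Quotient.sound (InvJet.symm_comp_eq f))).trans
    (translate_refl j)

theorem InvJet.translate_translate_inv {x : M} {y : M'} (α : InvJet n (r + 1) x y)
    (j : SectionJet G r y) : α.translate (α.inv.translate j) = j := by
  rw [← translate_comp]
  obtain ⟨f, rfl⟩ := Quotient.exists_rep α
  exact (congrArg (InvJet.translate · j) (Quotient.sound (InvJet.comp_symm_eq f))).trans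
    (translate_refl j)

variable (n r G) in
/-- The action of the group of `(r+1)`-jets at `0` on `J₀ʳ(FV/G)`. -/
@[reducible] def jetGroupAction :
    MulAction (JetGroup n (r + 1)) (SectionJet G r (0 : V n)) where
  smul α j := α.translate j
  one_smul j := InvJet.translate_refl j
  mul_smul β α j := InvJet.translate_comp β α j

theorem sameOrbit_mk_iff {x y : M} {j : SectionJet G r x} {j' : SectionJet G r y} :
    SameOrbit (M := M) ⟨x, j⟩ ⟨y, j'⟩ ↔ ∃ α : InvJet n (r + 1) x y, α.translate j = j' :=
  exists_congr fun _ => isTranslate_iff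

theorem sameOrbit_equivalence : Equivalence (SameOrbit (M := M) (G := G) (r := r)) where
  refl := fun ⟨x, j⟩ => sameOrbit_mk_iff.2 ⟨.mk _ (.refl x), InvJet.translate_refl j⟩
  symm := by
    rintro ⟨x, j⟩ ⟨y, j'⟩ h
    obtain ⟨α, rfl⟩ := sameOrbit_mk_iff.1 h
    exact sameOrbit_mk_iff.2 ⟨α.inv, α.translate_inv_translate j⟩
  trans := by
    rintro ⟨x, j⟩ ⟨y, j'⟩ ⟨z, j''⟩ h h'
    obtain ⟨α, rfl⟩ := sameOrbit_mk_iff.1 h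
    obtain ⟨β, rfl⟩ := sameOrbit_mk_iff.1 h'
    exact sameOrbit_mk_iff.2 ⟨β.comp α, InvJet.translate_comp β α j⟩

theorem Moduli.mk_eq_iff {x y : M} {j : SectionJet G r x} {j' : SectionJet G r y} :
    Moduli.mk j = Moduli.mk j' ↔ ∃ α : InvJet n (r + 1) x y, α.translate j = j' :=
  (Quot.eq.trans (sameOrbit_equivalence.eqvGen_iff)).trans sameOrbit_mk_iff

theorem Moduli.exists_mk_eq (w : Moduli M G r) :
    ∃ (x : M) (j : SectionJet G r x), Moduli.mk j = w := by
  obtain ⟨⟨x, j⟩, rfl⟩ := Quot.exists_rep w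
  exact ⟨x, j, rfl⟩

variable (n) in
/-- The chart of the atlas at `x`, translated so that it maps `x` to `0`. -/
def centeredChart (x : M) : LocalDiffeoAt n x (0 : V n) where
  toDiffeo :=
    PartialDiffeomorph.trans
      { toPartialEquiv := (chartAt (V n) x).toPartialEquiv
        open_source := (chartAt (V n) x).open_source
        open_target := (chartAt (V n) x).open_target
        contMDiffOn_toFun := contMDiffOn_chart
        contMDiffOn_invFun := contMDiffOn_chart_symm }
      (Diffeomorph.toPartialDiffeomorph (n := ∞) (I := 𝓘(ℝ, V n)) (J := 𝓘(ℝ, V n))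
        { toEquiv := Equiv.subRight (chartAt (V n) x x)
          contMDiff_toFun := (contDiff_id.sub contDiff_const).contMDiff
          contMDiff_invFun := (contDiff_id.add contDiff_const).contMDiff })
  mem_source := ⟨mem_chart_source _ x, trivial⟩
  map_eq := sub_self (chartAt (V n) x x)

variable (n r G) in
/-- The quotient `J₀ʳ(FV/G)/𝔊₀^{r+1}`. -/
abbrev JetOrbits : Type _ :=
  @MulAction.orbitRel.Quotient (JetGroup n (r + 1)) (SectionJet G r (0 : V n)) _
    (jetGroupAction n r G)

/-- The class of `t` modulo the jet group. -/
def JetOrbits.mk (t : SectionJet G r (0 : V n)) : JetOrbits n r G := Quotient.mk _ t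

theorem JetOrbits.mk_eq_iff {t t' : SectionJet G r (0 : V n)} :
    JetOrbits.mk t = JetOrbits.mk t' ↔ ∃ α : JetGroup n (r + 1), α.translate t = t' :=
  letI := jetGroupAction n r G
  eq_comm.trans <| (Quotient.eq (r := MulAction.orbitRel (JetGroup n (r + 1)) _)).trans
    MulAction.orbitRel_apply

/-- Two jets are equivalent on `M` exactly when their images under centered charts are equivalent
under the jet group. -/
theorem JetOrbits.mk_translate_eq_iff {x y : M} {φ : InvJet n (r + 1) x (0 : V n)}
    {ψ : InvJet n (r + 1) y (0 : V n)} {j : SectionJet G r x} {j' : SectionJet G r y} :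
    JetOrbits.mk (φ.translate j) = JetOrbits.mk (ψ.translate j') ↔
      Moduli.mk j = Moduli.mk j' := by
  refine JetOrbits.mk_eq_iff.trans (Iff.trans ⟨?_, ?_⟩ Moduli.mk_eq_iff.symm)
  · rintro ⟨γ, h⟩
    refine ⟨ψ.inv.comp (γ.comp φ), ?_⟩
    rw [InvJet.translate_comp, InvJet.translate_comp, h, InvJet.translate_inv_translate]
  · rintro ⟨α, rfl⟩
    refine ⟨ψ.comp (α.comp φ.inv), ?_⟩
    rw [InvJet.translate_comp, InvJet.translate_comp, InvJet.translate_inv_translate]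

variable (n r M G) in
/-- The bijection induced on classes by `j ↦ φ · j`, where `φ` is a chart centered at the base
point of `j`. -/
def moduliEquiv [Nonempty M] :
    Moduli M G r ≃ JetOrbits n r G := by
  refine Equiv.ofBijective (Quot.lift (fun j => JetOrbits.mk
    ((InvJet.mk (r + 1) (centeredChart n j.1)).translate j.2)) ?_) ⟨?_, ?_⟩
  · rintro ⟨x, j⟩ ⟨y, j'⟩ h
    exact JetOrbits.mk_translate_eq_iff.2 (Quot.sound h)
  · rintro ⟨x, j⟩ ⟨y, j'⟩ h
    exact JetOrbits.mk_translate_eq_iff.1 h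
  · rintro ⟨t⟩
    obtain ⟨x⟩ := ‹Nonempty M›
    refine ⟨Moduli.mk ((InvJet.mk (r + 1) (centeredChart n x)).inv.translate t), ?_⟩
    exact congrArg JetOrbits.mk (InvJet.translate_translate_inv _ t)

theorem moduliEquiv_mk [Nonempty M] {x : M} (φ : InvJet n (r + 1) x (0 : V n))
    (j : SectionJet G r x) : moduliEquiv n r M G (.mk j) = JetOrbits.mk (φ.translate j) :=
  JetOrbits.mk_translate_eq_iff.2 rfl

theorem moduliEquiv_translate [Nonempty M] [Nonempty M'] {x : M} {y : M'}
    (α : InvJet n (r + 1) x y) (j : SectionJet G r x) :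
    moduliEquiv n r M' G (.mk (α.translate j)) = moduliEquiv n r M G (.mk j) := by
  rw [moduliEquiv_mk (InvJet.mk (r + 1) (centeredChart n y)), ← InvJet.translate_comp,
    ← moduliEquiv_mk]

end Action

end GJet

end

theorem mainTheorem3 (n r : ℕ) (G : Subgroup (GL (Fin n) ℝ))
    (hG : IsClosed (G : Set (GL (Fin n) ℝ)))
    (M : Type*) [TopologicalSpace M] [ChartedSpace (GJet.V n) M]
    [IsManifold 𝓘(ℝ, GJet.V n) ∞ M] [Nonempty M]
    (M' : Type*) [TopologicalSpace M'] [ChartedSpace (GJet.V n) M']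
    [IsManifold 𝓘(ℝ, GJet.V n) ∞ M'] [Nonempty M'] :
    -- `(j^{r+1} f) · (j^r s) = j^r (f · s)` is well defined, for local diffeomorphisms `M → M'`
    (∀ (x : M) (y : M') (α : GJet.InvJet n (r + 1) x y) (j : GJet.SectionJet G r x),
      ∃! j' : GJet.SectionJet G r y, GJet.IsTranslate α j j') ∧
    -- it is an action of the groupoid of invertible `(r+1)`-jets of `M`, and being in the same
    -- orbit is an equivalence relation
    (∀ (x : M) (j : GJet.SectionJet G r x), GJet.IsTranslate (.mk (r + 1) (.refl x)) j j) ∧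
    (∀ (x y z : M) (α : GJet.InvJet n (r + 1) x y) (β : GJet.InvJet n (r + 1) y z)
      (j : GJet.SectionJet G r x) (j' : GJet.SectionJet G r y) (j'' : GJet.SectionJet G r z),
      GJet.IsTranslate α j j' → GJet.IsTranslate β j' j'' →
        GJet.IsTranslate (β.comp α) j j'') ∧
    Equivalence (GJet.SameOrbit (M := M) (G := G) (r := r)) ∧
    -- the group of `(r+1)`-jets at `0` acts on `J₀ʳ(FV/G)`, and the moduli space is canonically
    -- the quotient: the class of `j` goes to the class of `φ · j` for each chart `φ` centered at
    -- the base point of `j`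
    (∃ _ : MulAction (GJet.JetGroup n (r + 1)) (GJet.SectionJet G r (0 : GJet.V n)),
      (∀ (α : GJet.JetGroup n (r + 1)) (j j' : GJet.SectionJet G r (0 : GJet.V n)),
        α • j = j' ↔ GJet.IsTranslate α j j') ∧
      ∃! Φ : GJet.Moduli M G r ≃
          MulAction.orbitRel.Quotient (GJet.JetGroup n (r + 1))
            (GJet.SectionJet G r (0 : GJet.V n)),
        ∀ (x : M) (φ : GJet.InvJet n (r + 1) x (0 : GJet.V n)) (j : GJet.SectionJet G r x)
          (t : GJet.SectionJet G r (0 : GJet.V n)),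
          GJet.IsTranslate φ j t → Φ (.mk j) = Quotient.mk _ t) ∧
    -- the moduli space does not depend on the manifold
    (∃! Ψ : GJet.Moduli M G r ≃ GJet.Moduli M' G r,
      ∀ (x : M) (y : M') (α : GJet.InvJet n (r + 1) x y) (j : GJet.SectionJet G r x)
        (j' : GJet.SectionJet G r y), GJet.IsTranslate α j j' → Ψ (.mk j) = .mk j') := by
  refine ⟨fun x y α j => ⟨α.translate j, GJet.isTranslate_iff.2 rfl, fun j' h =>
      (GJet.isTranslate_iff.1 h).symm⟩, fun x j => GJet.isTranslate_iff.2 (GJet.InvJet.translate_refl j),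
    fun x y z α β j j' j'' h h' => ?_, GJet.sameOrbit_equivalence,
    ⟨GJet.jetGroupAction n r G, fun α j j' => GJet.isTranslate_iff.symm,
      GJet.moduliEquiv n r M G, fun x φ j t h => ?_, fun Φ hΦ => ?_⟩,
    (GJet.moduliEquiv n r M G).trans (GJet.moduliEquiv n r M' G).symm,
    fun x y α j j' h => ?_, fun Ψ hΨ => ?_⟩
  · rw [GJet.isTranslate_iff] at h h' ⊢
    rw [GJet.InvJet.translate_comp, h, h']
  · rw [← GJet.isTranslate_iff.1 h]
    exact GJet.moduliEquiv_mk φ j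
  · refine Equiv.ext fun w => ?_
    obtain ⟨x, j, rfl⟩ := GJet.Moduli.exists_mk_eq w
    let φ := GJet.InvJet.mk (r + 1) (GJet.centeredChart n x)
    exact (hΦ x φ j _ (GJet.isTranslate_iff.2 rfl)).trans (GJet.moduliEquiv_mk φ j).symm
  · rw [← GJet.isTranslate_iff.1 h, Equiv.trans_apply, Equiv.symm_apply_eq,
      GJet.moduliEquiv_translate]
  · refine Equiv.ext fun w => ?_
    obtain ⟨x, j, rfl⟩ := GJet.Moduli.exists_mk_eq w
    obtain ⟨y⟩ := ‹Nonempty M'›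
    let α := (GJet.InvJet.mk (r + 1) (GJet.centeredChart n y)).inv.comp
      (GJet.InvJet.mk (r + 1) (GJet.centeredChart n x))
    refine (hΨ x y α j _ (GJet.isTranslate_iff.2 rfl)).trans ?_
    rw [Equiv.trans_apply, Equiv.eq_symm_apply]
    exact GJet.moduliEquiv_translate α j
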